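/- Let $(R,\mathfrak m,k)$ be a one-dimensional Noetherian local domain with infinite residue field $k$ and fraction field $K$. Assume that the integral closure $\overline R$ of $R$ in $K$ is a finite $R$-module and a discrete valuation ring, and that $R$ is residually rational, i.e. the natural map from $k$ to the residue field of $\overline R$ is an isomorphism. For $R$-submodules $M,N\subseteq K$ put $M:N=\{y\in K\mid yN\subseteq M\}$, and let $\ell$ denote length over $R$. Let $\omega$ be a canonical module of $R$, chosen so that $R\subseteq\omega\subseteq\overline R$. Let $I$ be an $\mathfrak m$-primary ideal of $R$ that is not principal, and let $\Lambda=\bigcup_{n\ge 0}(I^n:I^n)$ be the blowing-up of $R$ along $I$. Let $h_I(z)\in\mathbb Z[z]$ be the polynomial with $\sum_{n\ge0}\ell(I^n/I^{n+1})z^n=h_I(z)/(1-z)$, and let $e=h_I(1)$ and $\rho=h_I'(1)$ be the multiplicity and the genus of $I$. Let $x\in I$ be a minimal reduction of $I$, i.e. $I^{n+1}=xI^n$ for all $n\gg0$, and let $\nu$ be the least integer such that $I^{n+1}=xI^n$ for all $n\ge\nu$. Put $\delta=\ell(\overline R/R)$, $c=\ell(\overline R/(R:\overline R))$ and $c_\Lambda=\ell(\overline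 R/(\Lambda:\overline R))$. All these lengths are finite, $h_I$ exists, $I^\nu\subseteq R:\Lambda$, $\Lambda\subseteq\omega\Lambda$, the lengths $\ell((R:\Lambda)/I^\nu)$ and $\ell(\omega\Lambda/\Lambda)$ are finite, and: 1. $2\rho=e\nu+(2\delta-c)-\ell\big((R:\Lambda)/I^{\nu}\big)-\ell(\omega\Lambda/\Lambda)$; in particular $2\rho\le e\nu+(2\delta-c)$. 2. The following are equivalent: (a) $2\rho=e\nu+(2\delta-c)$; (b) $\Lambda$ is Gorenstein and $c-c_\Lambda=e\nu$; (c) $R:\Lambda=I^\nu$ and $\omega\Lambda=\Lambda$; (d) $R:\Lambda=I^\nu\subseteq R:\omega$. -/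

import Mathlib

universe u

open CategoryTheory

noncomputable section

namespace BlowUp

section Homological

/-- A finitely generated module `M` over a Noetherian local ring `(A, 𝔪, k)` of Krull dimension `d`
is a canonical module if `Ext^i_A(k, M) = 0` for `i ≠ d` and `Ext^d_A(k, M) ≅ k`. -/
structure IsCanonicalModule (A : Type u) [CommRing A] [IsLocalRing A] (d : ℕ)
    (M : Type u) [AddCommGroup M] [Module A M] : Prop where
  finite : Module.Finite A M
  dim_eq : ringKrullDim A = d
  ext_eq_zero : ∀ i : ℕ, i ≠ d → Subsingleton
    (Abelian.Ext (ModuleCat.of A (IsLocalRing.ResidueField A)) (ModuleCat.of A M) i)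
  ext_equiv : Nonempty
    (Abelian.Ext (ModuleCat.of A (IsLocalRing.ResidueField A)) (ModuleCat.of A M) d
      ≃ₗ[A] IsLocalRing.ResidueField A)

/-- A Gorenstein local ring: a Noetherian local ring of finite injective dimension over itself. -/
structure IsGorensteinLocalRing (A : Type u) [CommRing A] : Prop where
  isLocalRing : IsLocalRing A
  isNoetherianRing : IsNoetherianRing A
  finite_injectiveDimension : ∃ n : ℕ, HasInjectiveDimensionLT (ModuleCat.of A A) n

end Homological

section Ring

variable {R : Type u} [CommRing R]

/-- The length of the `R`-module `I^n / I^(n+1)`. -/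
def hilbertLength (I : Ideal R) (n : ℕ) : ℕ∞ :=
  Module.length R (↥(I ^ n) ⧸ (I ^ (n + 1)).submoduleOf (I ^ n))

/-- The Hilbert–Poincaré series `∑ ℓ(I^n / I^(n+1)) z^n`. -/
def hilbertSeries (I : Ideal R) : PowerSeries ℤ :=
  PowerSeries.mk fun n => ((hilbertLength I n).toNat : ℤ)

/-- `h` is the numerator of the Hilbert–Poincaré series over the denominator `1 - z`. -/
def IsHPolynomial (I : Ideal R) (h : Polynomial ℤ) : Prop :=
  (h : PowerSeries ℤ) = (1 - PowerSeries.X) * hilbertSeries I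

open Classical in
/-- The `h`-polynomial of `I` (and `0` if the series is not of the form `h(z) / (1 - z)`). -/
def hPolynomial (I : Ideal R) : Polynomial ℤ :=
  if H : ∃ h, IsHPolynomial I h then H.choose else 0

/-- The multiplicity `e(I) = h_I(1)`. -/
def multiplicity (I : Ideal R) : ℤ := (hPolynomial I).eval 1

/-- The genus `ρ(I) = h_I'(1)`. -/
def genus (I : Ideal R) : ℤ := (Polynomial.derivative (hPolynomial I)).eval 1

/-- `x ∈ I` is a minimal reduction of `I`: `I^(n+1) = x I^n` for `n ≫ 0`. -/
def IsMinimalReduction (I : Ideal R) (x : R) : Prop :=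
  x ∈ I ∧ ∃ N : ℕ, ∀ n ≥ N, I ^ (n + 1) = Ideal.span {x} * I ^ n

/-- The reduction exponent `ν`: the least integer such that `I^(n+1) = x I^n` for all `n ≥ ν`. -/
def reductionExponent (I : Ideal R) (x : R) : ℕ :=
  sInf {m : ℕ | ∀ n ≥ m, I ^ (n + 1) = Ideal.span {x} * I ^ n}

end Ring

section Fractional

variable {R : Type u} [CommRing R] {K : Type u} [Field K] [Algebra R K]

/-- The length of the `R`-module `M / N`, for `R`-submodules `N ⊆ M` of `K`. -/
def quotLength (M N : Submodule R K) : ℕ∞ :=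
  Module.length R (↥M ⧸ N.submoduleOf M)

variable (K) in
/-- The power `I^n`, as an `R`-submodule of `K`. -/
def idealPow (I : Ideal R) (n : ℕ) : Submodule R K :=
  IsLocalization.coeSubmodule K (I ^ n)

theorem div_idealPow_mono (I : Ideal R) :
    Monotone fun n => idealPow K I n / idealPow K I n := by
  refine monotone_nat_of_le_succ fun n x hx => ?_
  simp only [Submodule.mem_div_iff_forall_mul_mem] at hx ⊢
  have e : idealPow K I (n + 1) = idealPow K I n * idealPow K I 1 := by
    simp [idealPow, pow_succ, IsLocalization.coeSubmodule_mul]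
  intro y hy
  rw [e] at hy ⊢
  induction hy using Submodule.mul_induction_on' with
  | mem_mul_mem a ha b hb =>
    rw [← mul_assoc]
    exact Submodule.mul_mem_mul (hx a ha) hb
  | add a _ b _ ha hb =>
    rw [mul_add]
    exact add_mem ha hb

variable (K) in
/-- The blowing-up `Λ(I) = ⋃ₙ (I^n : I^n)` of `R` along `I`, a subring of `K` containing `R`.
Here `M / N` is Mathlib's notation for the colon `M : N = {x ∈ K | x N ⊆ M}`. -/
def blowup (I : Ideal R) : Subalgebra R K where
  carrier := ⋃ n : ℕ, ((idealPow K I n / idealPow K I n : Submodule R K) : Set K)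
  mul_mem' := by
    intro a b ha hb
    obtain ⟨m, hm⟩ := Set.mem_iUnion.1 ha
    obtain ⟨n, hn⟩ := Set.mem_iUnion.1 hb
    have hm' := div_idealPow_mono I (le_max_left m n) hm
    have hn' := div_idealPow_mono I (le_max_right m n) hn
    refine Set.mem_iUnion.2 ⟨max m n, ?_⟩
    simp only [SetLike.mem_coe, Submodule.mem_div_iff_forall_mul_mem] at hm' hn' ⊢
    intro y hy
    rw [mul_assoc]
    exact hm' _ (hn' _ hy)
  add_mem' := by
    intro a b ha hb
    obtain ⟨m, hm⟩ := Set.mem_iUnion.1 ha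
    obtain ⟨n, hn⟩ := Set.mem_iUnion.1 hb
    exact Set.mem_iUnion.2 ⟨max m n, add_mem (div_idealPow_mono I (le_max_left m n) hm)
      (div_idealPow_mono I (le_max_right m n) hn)⟩
  algebraMap_mem' := by
    intro r
    refine Set.mem_iUnion.2 ⟨0, ?_⟩
    simp only [SetLike.mem_coe, Submodule.mem_div_iff_forall_mul_mem]
    intro y hy
    rw [← Algebra.smul_def]
    exact Submodule.smul_mem _ r hy

variable (R K) in
/-- The integral closure of `R` in `K`, as an `R`-submodule of `K`. -/
def Rbar : Submodule R K := Subalgebra.toSubmodule (integralClosure R K)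

/-- For a subring `R ⊆ S ⊆ K`, the length over `R` of `R̄ / S` (for `S = R`, the singularity
degree `δ`). -/
def deltaLength (S : Subalgebra R K) : ℕ∞ :=
  quotLength (Rbar R K) (Subalgebra.toSubmodule S)

/-- For a subring `R ⊆ S ⊆ K`, the length over `R` of `R̄ / (S : R̄)` (for `S = R`, the
conductor `c`). -/
def condLength (S : Subalgebra R K) : ℕ∞ :=
  quotLength (Rbar R K) (Subalgebra.toSubmodule S / Rbar R K)

end Fractional

end BlowUp

end

/-!
Lengths of quotients of lattices in `K` are differences of degrees. A lattice `W` with `K / W`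
injective is dualizing, because then `Hom(-, K / W)` separates points: `M ↦ W : M` is an involution
on lattices, and `deg (W : M) = deg W - deg M`. The converse is Baer's criterion. Since `K` is
injective, `Ext²(k, ω) = 0` makes `K / ω` injective, so the canonical module `ω` is dualizing.

The blowing-up satisfies `x ^ ν Λ = I ^ ν`, and summing the Hilbert series gives `ρ = deg Λ` and
`deg (I ^ ν) = deg Λ - e ν`. Moreover `R : M = ω : ωM`, which for `M = R̄` gives `2 δ - c = deg ω`
and for `M = Λ` gives `deg (R : Λ) = deg ω - deg (ωΛ)`; the formula for `2 ρ` follows. Finally `Λ`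
is Gorenstein if and only if its canonical module `ω : Λ` is principal over `Λ`, and each of the
conditions (b), (c) and (d) says that `ω : Λ = x ^ ν Λ`.
-/

namespace BlowUp

open IsLocalRing

section RelativeLength

variable {A : Type*} [CommRing A]

theorem length_quotient_map {E F : Type*} [AddCommGroup E] [Module A E] [AddCommGroup F]
    [Module A F] (f : E →ₗ[A] F) (hf : Function.Injective f) (M N : Submodule A E) :
    Module.length A (↥(M.map f) ⧸ (N.map f).submoduleOf (M.map f)) =
      Module.length A (↥M ⧸ N.submoduleOf M) := by
  refine (LinearEquiv.length_eq (Submodule.Quotient.equiv _ _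
    (Submodule.equivMapOfInjective f hf M) ?_)).symm
  ext ⟨y, hy⟩
  obtain ⟨m, hm, rfl⟩ := hy
  simp only [Submodule.mem_map, Submodule.submoduleOf, Submodule.mem_comap]
  constructor
  · rintro ⟨z, hz, h⟩
    exact ⟨z, hz, congrArg Subtype.val h⟩
  · rintro ⟨z, hz, h⟩
    have : z = m := hf h
    subst this
    exact ⟨⟨z, hm⟩, hz, rfl⟩

theorem isFiniteLength_of_smul_eq_zero [IsNoetherianRing A] [Ring.KrullDimLE 1 A] {X : Type*}
    [AddCommGroup X] [Module A X] [Module.Finite A X] {a : A} (ha : a ∈ nonZeroDivisors A)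
    (h : ∀ x : X, a • x = 0) : IsFiniteLength A X := by
  rw [isFiniteLength_iff_isNoetherian_isArtinian]
  refine ⟨inferInstance, ?_⟩
  have ht : Module.IsTorsionBySet A X (Ideal.span {a} : Ideal A) := by
    rw [Module.isTorsionBySet_span_singleton_iff]
    exact fun x => h x
  let _ := ht.module
  have : IsScalarTower A (A ⧸ Ideal.span {a}) X := ht.isScalarTower
  have hfl := (isFiniteLength_iff_isNoetherian_isArtinian.1
    (isFiniteLength_quotient_span_singleton A ha)).2
  have : IsArtinianRing (A ⧸ Ideal.span {a}) := isArtinian_of_tower A hfl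
  have : Module.Finite (A ⧸ Ideal.span {a}) X := Module.Finite.of_restrictScalars_finite A _ X
  exact isArtinian_of_surjective_algebraMap (R := A ⧸ Ideal.span {a}) (S := A)
    Ideal.Quotient.mk_surjective

end RelativeLength

section HomLength

variable {A : Type*} [CommRing A]

theorem length_le_add_of_exact {X Y Z : Type*} [AddCommGroup X] [Module A X] [AddCommGroup Y]
    [Module A Y] [AddCommGroup Z] [Module A Z] {f : X →ₗ[A] Y} {g : Y →ₗ[A] Z}
    (h : Function.Exact f g) : Module.length A Y ≤ Module.length A X + Module.length A Z := by
  rw [Module.length_eq_add_of_exact g.ker.subtype g.rangeRestrict g.ker.subtype_injective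
    g.surjective_rangeRestrict (by
      rw [LinearMap.exact_iff, LinearMap.ker_rangeRestrict, Submodule.range_subtype]),
    h.linearMap_ker_eq]
  exact add_le_add (Module.length_le_of_surjective _ f.surjective_rangeRestrict)
    (Module.length_le_of_injective _ g.range.subtype_injective)

variable [IsLocalRing A]

theorem nonempty_linearEquiv_residueField (X : Type*) [AddCommGroup X] [Module A X]
    [IsSimpleModule A X] : Nonempty (X ≃ₗ[A] ResidueField A) := by
  obtain ⟨p, hp, e⟩ := isSimpleModule_iff_quot_maximal.1 ‹IsSimpleModule A X›
  rwa [eq_maximalIdeal hp] at e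

theorem length_linearMap_le {E X : Type*} [AddCommGroup E] [Module A E] [AddCommGroup X]
    [Module A X] (hE : Module.length A (ResidueField A →ₗ[A] E) ≤ 1) (hX : IsFiniteLength A X) :
    Module.length A (X →ₗ[A] E) ≤ Module.length A X := by
  induction hX with
  | of_subsingleton => simp [Module.length_eq_zero]
  | @of_simple_quotient X _ _ N _ _ ih =>
    obtain ⟨e⟩ := nonempty_linearEquiv_residueField (A := A) (X ⧸ N)
    have h : Module.length A (X ⧸ N →ₗ[A] E) ≤ 1 :=
      (e.congrLeft E A).length_eq.trans_le hE
    have hx := LinearMap.exact_lcomp_of_exact_of_surjective E (LinearMap.exact_subtype_mkQ N)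
      N.mkQ_surjective
    calc Module.length A (X →ₗ[A] E)
        ≤ Module.length A (X ⧸ N →ₗ[A] E) + Module.length A (N →ₗ[A] E) :=
          length_le_add_of_exact hx
      _ ≤ 1 + Module.length A N := add_le_add h ih
      _ = Module.length A X := by
          rw [add_comm, Module.length_eq_add_of_exact N.subtype N.mkQ N.subtype_injective
            N.mkQ_surjective (LinearMap.exact_subtype_mkQ N), Module.length_eq_one A (X ⧸ N)]

end HomLength

/-! ### Lattices and degrees -/

section Lattice

variable {A : Type u} [CommRing A] {K : Type u} [Field K] [Algebra A K]

theorem quotLength_eq_zero_iff {M N : Submodule A K} : quotLength M N = 0 ↔ M ≤ N := by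
  rw [quotLength, Module.length_eq_zero_iff, Submodule.Quotient.subsingleton_iff,
    Submodule.submoduleOf_eq_top]

theorem quotLength_add {M N P : Submodule A K} (hPN : P ≤ N) (hNM : N ≤ M) :
    quotLength M P = quotLength N P + quotLength M N := by
  have h1 : P.submoduleOf N ≤ (P.submoduleOf M).comap (Submodule.inclusion hNM) :=
    fun x hx => hx
  have h2 : P.submoduleOf M ≤ (N.submoduleOf M).comap LinearMap.id := fun x hx => hPN hx
  refine Module.length_eq_add_of_exact
    (Submodule.mapQ _ _ (Submodule.inclusion hNM) h1) (Submodule.mapQ _ _ LinearMap.id h2)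
    ?_ ?_ ?_
  · rw [← LinearMap.ker_eq_bot, Submodule.ker_mapQ, ← le_bot_iff, Submodule.map_le_iff_le_comap]
    intro x hx
    rw [Submodule.mem_comap, Submodule.mem_bot, Submodule.mkQ_apply, Submodule.Quotient.mk_eq_zero]
    exact hx
  · intro y
    obtain ⟨y, rfl⟩ := Submodule.Quotient.mk_surjective _ y
    exact ⟨Submodule.Quotient.mk y, rfl⟩
  · intro y
    obtain ⟨y, rfl⟩ := Submodule.Quotient.mk_surjective _ y
    rw [Submodule.mapQ_apply, LinearMap.id_apply, Submodule.Quotient.mk_eq_zero]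
    constructor
    · intro hy
      exact ⟨Submodule.Quotient.mk ⟨y.1, hy⟩, rfl⟩
    · rintro ⟨z, hz⟩
      obtain ⟨z, rfl⟩ := Submodule.Quotient.mk_surjective _ z
      rw [Submodule.mapQ_apply, Submodule.Quotient.eq] at hz
      have h3 : (z : K) - y ∈ N := hPN hz
      have := N.sub_mem z.2 h3
      simpa [Submodule.submoduleOf] using this

theorem span_singleton_mul_eq_map (y : K) (M : Submodule A K) :
    Submodule.span A {y} * M = M.map (LinearMap.mulLeft A y) := by
  ext z
  simp [Submodule.mem_span_singleton_mul]

theorem quotLength_span_singleton_mul {y : K} (hy : y ≠ 0) (M N : Submodule A K) :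
    quotLength (Submodule.span A {y} * M) (Submodule.span A {y} * N) = quotLength M N := by
  rw [span_singleton_mul_eq_map, span_singleton_mul_eq_map]
  exact length_quotient_map _ (mul_right_injective₀ hy) M N

variable (A) in
theorem span_singleton_inv_mul_span_singleton {y : K} (hy : y ≠ 0) :
    Submodule.span A {y⁻¹} * Submodule.span A {y} = 1 := by
  simp only [← Submodule.spanSingleton_apply, ← map_mul, inv_mul_cancel₀ hy, map_one]

theorem span_singleton_mul_le_iff {y : K} (hy : y ≠ 0) {M N : Submodule A K} :
    Submodule.span A {y} * M ≤ N ↔ M ≤ Submodule.span A {y⁻¹} * N := by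
  constructor
  · intro h
    have := mul_le_mul_right h (Submodule.span A {y⁻¹})
    rwa [← mul_assoc, span_singleton_inv_mul_span_singleton A hy, one_mul] at this
  · intro h
    have := mul_le_mul_right h (Submodule.span A {y})
    rwa [← mul_assoc, mul_comm (Submodule.span A {y}) (Submodule.span A {y⁻¹}),
      span_singleton_inv_mul_span_singleton A hy, one_mul] at this

theorem div_mul_eq_div_div (M N P : Submodule A K) : M / (N * P) = (M / N) / P := by
  refine eq_of_forall_le_iff fun Q => ?_
  rw [Submodule.le_div_iff_mul_le, Submodule.le_div_iff_mul_le, Submodule.le_div_iff_mul_le,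
    mul_assoc, mul_comm P N]

theorem div_le_div_left {M N : Submodule A K} (h : N ≤ M) (W : Submodule A K) :
    W / M ≤ W / N := by
  rw [Submodule.le_div_iff_mul_le]
  exact (mul_le_mul_right h _).trans (Submodule.le_div_iff_mul_le.1 le_rfl)

theorem div_le_div_right {M N : Submodule A K} (h : N ≤ M) (W : Submodule A K) :
    N / W ≤ M / W := by
  rw [Submodule.le_div_iff_mul_le]
  exact (Submodule.le_div_iff_mul_le.1 le_rfl).trans h

theorem le_div_div (W M : Submodule A K) : M ≤ W / (W / M) := by
  rw [Submodule.le_div_iff_mul_le, mul_comm]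
  exact Submodule.le_div_iff_mul_le.1 le_rfl

theorem div_one' (M : Submodule A K) : M / 1 = M := by
  refine eq_of_forall_le_iff fun Q => ?_
  rw [Submodule.le_div_iff_mul_le, mul_one]

theorem div_span_singleton_mul {y : K} (hy : y ≠ 0) (M N : Submodule A K) :
    M / (Submodule.span A {y} * N) = Submodule.span A {y⁻¹} * (M / N) := by
  refine eq_of_forall_le_iff fun Q => ?_
  rw [Submodule.le_div_iff_mul_le, ← span_singleton_mul_le_iff hy, Submodule.le_div_iff_mul_le,
    mul_left_comm, mul_assoc]

theorem span_singleton_mul_div {y : K} (hy : y ≠ 0) (M N : Submodule A K) :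
    (Submodule.span A {y} * M) / N = Submodule.span A {y} * (M / N) := by
  refine eq_of_forall_le_iff fun Q => ?_
  have h := fun P Q : Submodule A K =>
    span_singleton_mul_le_iff (A := A) (inv_ne_zero hy) (M := P) (N := Q)
  rw [inv_inv] at h
  rw [Submodule.le_div_iff_mul_le, ← h, ← h, Submodule.le_div_iff_mul_le, mul_assoc]

/-- A nonzero finitely generated submodule of a field; in the fraction field of a domain, this is
a fractional ideal that is nonzero and finitely generated. -/
structure IsLattice (M : Submodule A K) : Prop where
  ne_bot : M ≠ ⊥
  fg : M.FG

namespace IsLattice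

theorem one : IsLattice (1 : Submodule A K) :=
  ⟨one_ne_zero, by rw [Submodule.one_eq_span]; exact Submodule.fg_span_singleton 1⟩

theorem sup {M N : Submodule A K} (hM : IsLattice M) (hN : IsLattice N) : IsLattice (M ⊔ N) :=
  ⟨fun h => hM.ne_bot (le_bot_iff.1 (le_sup_left.trans h.le)), hM.fg.sup hN.fg⟩

theorem mul {M N : Submodule A K} (hM : IsLattice M) (hN : IsLattice N) : IsLattice (M * N) :=
  ⟨fun h => (Submodule.mul_eq_bot.1 h).elim hM.ne_bot hN.ne_bot, hM.fg.mul hN.fg⟩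

theorem span_singleton {y : K} (hy : y ≠ 0) : IsLattice (Submodule.span A {y}) :=
  ⟨by simpa using hy, Submodule.fg_span_singleton y⟩

theorem exists_mem_ne_zero {M : Submodule A K} (hM : IsLattice M) : ∃ y ∈ M, y ≠ 0 :=
  M.ne_bot_iff.1 hM.ne_bot

theorem of_le [IsNoetherianRing A] {M N : Submodule A K} (hM : IsLattice M) (hN : N ≠ ⊥)
    (h : N ≤ M) : IsLattice N := by
  refine ⟨hN, ?_⟩
  have : IsNoetherian A M := isNoetherian_of_fg_of_noetherian M hM.fg
  exact Submodule.FG.of_le hM.fg h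

variable [IsFractionRing A K]

theorem exists_span_singleton_mul_le {M N : Submodule A K} (hM : IsLattice M)
    (hN : IsLattice N) :
    ∃ b ∈ nonZeroDivisors A, Submodule.span A {algebraMap A K b} * M ≤ N := by
  obtain ⟨n, hn, hn0⟩ := hN.exists_mem_ne_zero
  obtain ⟨b, hb, h⟩ := FractionalIdeal.isFractional_of_fg (S := nonZeroDivisors A)
    ((IsLattice.span_singleton (inv_ne_zero hn0)).mul hM).fg
  refine ⟨b, hb, fun z hz => ?_⟩
  obtain ⟨m, hm, rfl⟩ := Submodule.mem_span_singleton_mul.1 hz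
  obtain ⟨a, ha⟩ := h (n⁻¹ * m) (Submodule.mul_mem_mul (Submodule.mem_span_singleton_self _) hm)
  have hab : algebraMap A K b * m = a • n := by
    rw [Algebra.smul_def, ha, Algebra.smul_def]
    field_simp
  exact hab ▸ N.smul_mem a hn

variable [IsNoetherianRing A]

theorem div {M N : Submodule A K} (hM : IsLattice M) (hN : IsLattice N) : IsLattice (M / N) := by
  obtain ⟨n, hn, hn0⟩ := hN.exists_mem_ne_zero
  refine IsLattice.of_le ((IsLattice.span_singleton (A := A) (inv_ne_zero hn0)).mul hM) ?_ ?_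
  · obtain ⟨b, hb, h⟩ := hN.exists_span_singleton_mul_le hM
    rw [← Submodule.le_div_iff_mul_le] at h
    have : Nontrivial A := (algebraMap A K).domain_nontrivial
    intro h0
    rw [h0, le_bot_iff, Submodule.span_singleton_eq_bot] at h
    exact (nonZeroDivisors.ne_zero hb) ((IsFractionRing.injective A K) (by simpa using h))
  · rw [← span_singleton_mul_le_iff hn0, mul_comm]
    exact (mul_le_mul_right ((Submodule.span_singleton_le_iff_mem _ _).2 hn) _).trans
      (Submodule.le_div_iff_mul_le.1 le_rfl)

variable [Ring.KrullDimLE 1 A]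

theorem quotLength_ne_top {M N : Submodule A K} (hM : IsLattice M) (hN : IsLattice N) :
    quotLength M N ≠ ⊤ := by
  obtain ⟨b, hb, h⟩ := hM.exists_span_singleton_mul_le hN
  have : Module.Finite A M := Module.Finite.iff_fg.2 hM.fg
  refine Module.length_ne_top_iff.2 (isFiniteLength_of_smul_eq_zero hb fun x => ?_)
  obtain ⟨x, rfl⟩ := Submodule.Quotient.mk_surjective _ x
  rw [← Submodule.Quotient.mk_smul, Submodule.Quotient.mk_eq_zero]
  change ((b • x : M) : K) ∈ N
  rw [Submodule.coe_smul, Algebra.smul_def]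
  exact h (Submodule.mul_mem_mul (Submodule.mem_span_singleton_self _) x.2)

end IsLattice

/-- The degree of a lattice: the length of `M` relative to `A`, computed in `M + A`. It turns
lengths of quotients into differences. -/
noncomputable def deg (M : Submodule A K) : ℤ :=
  ((quotLength (M ⊔ 1) 1).toNat : ℤ) - ((quotLength (M ⊔ 1) M).toNat : ℤ)

theorem deg_one : deg (1 : Submodule A K) = 0 := by
  simp [deg]

variable [IsNoetherianRing A] [IsFractionRing A K] [Ring.KrullDimLE 1 A]

theorem toNat_quotLength_add {M N P : Submodule A K} (hM : IsLattice M) (hN : IsLattice N)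
    (hP : IsLattice P) (hPN : P ≤ N) (hNM : N ≤ M) :
    (quotLength M P).toNat = (quotLength N P).toNat + (quotLength M N).toNat := by
  rw [quotLength_add hPN hNM,
    ENat.toNat_add (hN.quotLength_ne_top hP) (hM.quotLength_ne_top hN)]

theorem toNat_quotLength {M N : Submodule A K} (hM : IsLattice M) (hN : IsLattice N)
    (h : N ≤ M) : ((quotLength M N).toNat : ℤ) = deg M - deg N := by
  have h1 := IsLattice.one (A := A) (K := K)
  have hM1 := hM.sup h1
  have hN1 := hN.sup h1
  have hle : N ⊔ 1 ≤ M ⊔ 1 := sup_le_sup_right h 1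
  have e1 := toNat_quotLength_add hM1 hM hN h le_sup_left
  have e2 := toNat_quotLength_add hM1 hN1 hN le_sup_left hle
  have e3 := toNat_quotLength_add hM1 hN1 h1 le_sup_right hle
  unfold deg
  lia

theorem toNat_quotLength_eq_zero_iff {M N : Submodule A K} (hM : IsLattice M) (hN : IsLattice N)
    (h : N ≤ M) : (quotLength M N).toNat = 0 ↔ M = N := by
  rw [ENat.toNat_eq_zero, or_iff_left (hM.quotLength_ne_top hN), quotLength_eq_zero_iff]
  exact ⟨fun h' => h'.antisymm h, le_of_eq⟩

theorem eq_of_le_of_deg_le {M N : Submodule A K} (hM : IsLattice M) (hN : IsLattice N)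
    (h : N ≤ M) (hd : deg M ≤ deg N) : M = N := by
  rw [← toNat_quotLength_eq_zero_iff hM hN h]
  have := toNat_quotLength hM hN h
  lia

theorem deg_span_singleton_mul {y : K} (hy : y ≠ 0) {M : Submodule A K} (hM : IsLattice M) :
    deg (Submodule.span A {y} * M) = deg M + deg (Submodule.span A {y}) := by
  have hs := IsLattice.span_singleton (A := A) hy
  have key : ∀ N : Submodule A K, IsLattice N → N ≤ M ⊔ 1 →
      deg (Submodule.span A {y} * (M ⊔ 1)) - deg (Submodule.span A {y} * N) =
        deg (M ⊔ 1) - deg N := by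
    intro N hN h
    have h1 := hM.sup (IsLattice.one (A := A) (K := K))
    rw [← toNat_quotLength h1 hN h, ← toNat_quotLength (hs.mul h1) (hs.mul hN)
      (mul_le_mul_right h _), quotLength_span_singleton_mul hy]
  have k1 := key M hM le_sup_left
  have k2 := key 1 IsLattice.one le_sup_right
  rw [mul_one, deg_one] at k2
  lia

theorem deg_span_pow {y : K} (hy : y ≠ 0) (n : ℕ) :
    deg (Submodule.span A {y ^ n}) = n * deg (Submodule.span A {y}) := by
  induction n with
  | zero => simp [← Submodule.one_eq_span, deg_one]
  | succ n ih =>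
    rw [pow_succ', ← Set.singleton_mul_singleton, ← Submodule.span_mul_span,
      deg_span_singleton_mul hy (IsLattice.span_singleton (pow_ne_zero n hy)), ih]
    push_cast
    ring

end Lattice

/-! ### Dualizing lattices -/

section Baer

variable {A : Type*} [CommRing A] {Y : Type*} [AddCommGroup Y] [Module A Y]

theorem baer_of_forall_ne_bot
    (h : ∀ J : Ideal A, J ≠ ⊥ → ∀ f : J →ₗ[A] Y,
      ∃ g : A →ₗ[A] Y, ∀ (a : A) (ha : a ∈ J), g a = f ⟨a, ha⟩) : Module.Baer A Y := by
  intro J f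
  obtain rfl | hJ := eq_or_ne J ⊥
  · refine ⟨0, fun a ha => ?_⟩
    rw [LinearMap.zero_apply, Subsingleton.elim (⟨a, ha⟩ : (⊥ : Ideal A)) 0, map_zero]
  · exact h J hJ f

end Baer

section Duality

variable {A : Type u} [CommRing A] {K : Type u} [Field K] [Algebra A K]

/-- The pairing `(W : N) × M / N → K / W` given by multiplication in `K`, which compares the
colons `W : N` and `W : M` with the dual of `M / N`. -/
noncomputable def divToHom (W M N : Submodule A K) :
    ↥(W / N) →ₗ[A] (↥M ⧸ N.submoduleOf M) →ₗ[A] K ⧸ W where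
  toFun z := Submodule.mapQ _ W (LinearMap.mulLeft A (z : K) ∘ₗ M.subtype) fun n hn =>
    Submodule.mem_div_iff_forall_mul_mem.1 z.2 n hn
  map_add' _ _ := Submodule.linearMap_qext _ <| LinearMap.ext fun m =>
    congrArg W.mkQ (add_mul _ _ (m : K))
  map_smul' _ _ := Submodule.linearMap_qext _ <| LinearMap.ext fun m =>
    congrArg W.mkQ (smul_mul_assoc _ _ (m : K))

theorem ker_divToHom (W M N : Submodule A K) :
    (divToHom W M N).ker = (W / M).submoduleOf (W / N) := by
  ext z
  rw [LinearMap.mem_ker]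
  change _ ↔ (z : K) ∈ W / M
  rw [Submodule.mem_div_iff_forall_mul_mem]
  constructor
  · intro h m hm
    exact (Submodule.Quotient.mk_eq_zero W).1
      (LinearMap.congr_fun h (Submodule.Quotient.mk ⟨m, hm⟩))
  · intro h
    exact Submodule.linearMap_qext _ <| LinearMap.ext fun m =>
      (Submodule.Quotient.mk_eq_zero W).2 (h m m.2)

theorem quotLength_div_eq_length_range (W M N : Submodule A K) :
    quotLength (W / N) (W / M) = Module.length A (divToHom W M N).range := by
  rw [quotLength, ← ker_divToHom]
  exact (divToHom W M N).quotKerEquivRange.length_eq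

theorem IsLattice.coeSubmodule [IsNoetherianRing A] [IsFractionRing A K] {J : Ideal A}
    (hJ : J ≠ ⊥) : IsLattice (IsLocalization.coeSubmodule K J) :=
  ⟨fun h => hJ (IsFractionRing.coeSubmodule_injective A K
      (h.trans (IsLocalization.coeSubmodule_bot K).symm)),
    (IsLocalization.coeSubmodule_fg K (IsFractionRing.injective A K) J).2
      (IsNoetherian.noetherian J)⟩

theorem IsLattice.comap_mkQ {W : Submodule A K} (hW : IsLattice W) {S : Submodule A (K ⧸ W)}
    (hS : S.FG) : IsLattice (Submodule.comap W.mkQ S) := by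
  refine ⟨fun h => hW.ne_bot (le_bot_iff.1 (h ▸ W.le_comap_mkQ S)), ?_⟩
  refine Submodule.fg_of_fg_map_of_fg_inf_ker W.mkQ ?_ ?_
  · rwa [Submodule.map_comap_eq_of_surjective W.mkQ_surjective]
  · rw [Submodule.ker_mkQ, inf_eq_right.2 (W.le_comap_mkQ S)]
    exact hW.fg

/-- A dualizing lattice: `W : (W : M) = M` for every lattice `M`. These are the fractional canonical
ideals, characterized without homological algebra. -/
structure IsDualizing (W : Submodule A K) : Prop extends IsLattice W where
  div_div {M : Submodule A K} : IsLattice M → W / (W / M) = M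

theorem IsDualizing.div_self {W : Submodule A K} (hW : IsDualizing W) : W / W = 1 := by
  simpa only [div_one'] using hW.div_div IsLattice.one

variable [IsLocalRing A] {W : Submodule A K}

namespace IsDualizing

theorem comap_mkQ_range (hW : IsDualizing W) {f : ResidueField A →ₗ[A] K ⧸ W} (hf : f ≠ 0) :
    f.range.comap W.mkQ = W / IsLocalization.coeSubmodule K (maximalIdeal A) := by
  have hX := hW.toIsLattice.comap_mkQ (Submodule.fg_range f)
  refine (hW.div_div hX).symm.trans (congrArg (W / ·) ?_)
  apply le_antisymm
  · intro z hz
    obtain ⟨a, rfl⟩ := Submodule.mem_one.1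
      (hW.div_self ▸ div_le_div_left (W.le_comap_mkQ f.range) W hz)
    refine ⟨a, fun ha => hf (LinearMap.range_eq_bot.1 ?_), rfl⟩
    rw [eq_bot_iff, ← Submodule.comap_le_comap_iff_of_surjective W.mkQ_surjective]
    intro x hx
    rw [Submodule.comap_bot, Submodule.ker_mkQ]
    have hax : a • x ∈ W := by
      rw [Algebra.smul_def]
      exact Submodule.mem_div_iff_forall_mul_mem.1 hz x hx
    exact (W.smul_mem_iff_of_isUnit ha).1 hax
  · rw [Submodule.le_div_iff_mul_le, Submodule.mul_le]
    rintro _ ⟨a, ha, rfl⟩ x ⟨u, hu⟩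
    have : a • u = 0 := by
      rw [Algebra.smul_def, ResidueField.algebraMap_eq, (residue_eq_zero_iff a).2 ha, zero_mul]
    rw [Algebra.linearMap_apply, ← Algebra.smul_def, ← W.ker_mkQ, LinearMap.mem_ker, map_smul, ← hu,
      ← map_smul, this, map_zero]

theorem length_linearMap_residueField_le_one (hW : IsDualizing W) :
    Module.length A (ResidueField A →ₗ[A] K ⧸ W) ≤ 1 := by
  cases subsingleton_or_nontrivial (ResidueField A →ₗ[A] K ⧸ W) with
  | inl h => simp [Module.length_eq_zero]
  | inr h =>
    refine (Module.length_eq_one_iff.2 (isSimpleModule_iff_toSpanSingleton_surjective.2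
      ⟨h, fun f hf g => ?_⟩)).le
    have hle : g.range ≤ f.range := by
      obtain rfl | hg := eq_or_ne g 0
      · rw [LinearMap.range_zero]
        exact bot_le
      · rw [← Submodule.comap_le_comap_iff_of_surjective W.mkQ_surjective, hW.comap_mkQ_range hg,
          hW.comap_mkQ_range hf]
    obtain ⟨x, hx⟩ := hle ⟨1, rfl⟩
    obtain ⟨a, rfl⟩ := residue_surjective x
    refine ⟨a, LinearMap.ext fun y => ?_⟩
    obtain ⟨c, rfl⟩ := residue_surjective y
    have hc (r : A) : residue A r = r • (1 : ResidueField A) := by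
      rw [Algebra.smul_def, mul_one, ResidueField.algebraMap_eq]
    rw [hc a, map_smul] at hx
    rw [hc c, map_smul, map_smul, ← hx]
    rfl

variable [IsNoetherianRing A] [IsFractionRing A K] [Ring.KrullDimLE 1 A]

theorem quotLength_div_le (hW : IsDualizing W) {M N : Submodule A K} (hM : IsLattice M)
    (hN : IsLattice N) : quotLength (W / N) (W / M) ≤ quotLength M N := by
  rw [quotLength_div_eq_length_range]
  exact (Module.length_le_of_injective _ (Submodule.subtype_injective _)).trans
    (length_linearMap_le hW.length_linearMap_residueField_le_one
      (Module.length_ne_top_iff.1 (hM.quotLength_ne_top hN)))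

theorem quotLength_div (hW : IsDualizing W) {M N : Submodule A K} (hM : IsLattice M)
    (hN : IsLattice N) : quotLength (W / N) (W / M) = quotLength M N := by
  refine le_antisymm (hW.quotLength_div_le hM hN) ?_
  have := hW.quotLength_div_le (hW.div hN) (hW.div hM)
  rwa [hW.div_div hM, hW.div_div hN] at this

theorem deg_div (hW : IsDualizing W) {M : Submodule A K} (hM : IsLattice M) :
    deg (W / M) = deg W - deg M := by
  have key {M N : Submodule A K} (hM : IsLattice M) (hN : IsLattice N) (h : N ≤ M) :
      deg (W / N) - deg (W / M) = deg M - deg N := by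
    rw [← toNat_quotLength (hW.div hN) (hW.div hM) (div_le_div_left h W), hW.quotLength_div hM hN,
      toNat_quotLength hM hN h]
  have h₁ := IsLattice.one (A := A) (K := K)
  have hM₁ := key (hM.sup h₁) hM le_sup_left
  have h₁₁ := key (hM.sup h₁) h₁ le_sup_right
  rw [div_one', deg_one] at h₁₁
  lia

theorem divToHom_surjective (hW : IsDualizing W) {M N : Submodule A K} (hM : IsLattice M)
    (hN : IsLattice N) : Function.Surjective (divToHom W M N) := by
  have hfin := Module.length_ne_top_iff.1 (hM.quotLength_ne_top hN)
  have hle := length_linearMap_le hW.length_linearMap_residueField_le_one hfin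
  obtain ⟨_, _⟩ := isFiniteLength_iff_isNoetherian_isArtinian.1 (Module.length_ne_top_iff.1
    (ne_top_of_le_ne_top (Module.length_ne_top_iff.2 hfin) hle))
  rw [← LinearMap.range_eq_top]
  by_contra h
  refine ((Submodule.length_lt h).trans_le hle).ne ?_
  rw [← quotLength_div_eq_length_range, hW.quotLength_div hM hN, quotLength]

theorem exists_eq_mkQ_mul (hW : IsDualizing W) {M : Submodule A K} (hM : IsLattice M)
    (f : M →ₗ[A] K ⧸ W) : ∃ z : K, ∀ m : M, f m = W.mkQ (z * m) := by
  have : Module.Finite A M := Module.Finite.iff_fg.2 hM.fg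
  have hfW := hW.toIsLattice.comap_mkQ (Submodule.fg_range f)
  obtain ⟨b, hb, hbf⟩ := hfW.exists_span_singleton_mul_le hW.toIsLattice
  have : Nontrivial A := (algebraMap A K).domain_nontrivial
  have hs := IsLattice.span_singleton (A := A)
    (IsFractionRing.to_map_ne_zero_of_mem_nonZeroDivisors (K := K) hb)
  have hker : (Submodule.span A {algebraMap A K b} * M).submoduleOf M ≤ f.ker := by
    intro m hm
    obtain ⟨m', hm', h⟩ := Submodule.mem_span_singleton_mul.1 hm
    obtain rfl : b • ⟨m', hm'⟩ = m := Subtype.ext ((Algebra.smul_def b m').trans h)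
    obtain ⟨y, hy⟩ := Submodule.Quotient.mk_surjective W (f ⟨m', hm'⟩)
    rw [LinearMap.mem_ker, map_smul, ← hy, ← Submodule.Quotient.mk_smul,
      Submodule.Quotient.mk_eq_zero, Algebra.smul_def]
    exact hbf (Submodule.mul_mem_mul (Submodule.mem_span_singleton_self _) ⟨⟨m', hm'⟩, hy.symm⟩)
  obtain ⟨z, hz⟩ := hW.divToHom_surjective hM (hs.mul hM) (Submodule.liftQ _ f hker)
  exact ⟨z, fun m => (LinearMap.congr_fun hz (Submodule.Quotient.mk m)).symm⟩

theorem injective_quotient (hW : IsDualizing W) : Module.Injective A (K ⧸ W) := by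
  refine (baer_of_forall_ne_bot fun J hJ f => ?_).injective
  have : Nontrivial A := (algebraMap A K).domain_nontrivial
  let e : J ≃ₗ[A] IsLocalization.coeSubmodule K J :=
    J.equivMapOfInjective (Algebra.linearMap A K) (IsFractionRing.injective A K)
  obtain ⟨z, hz⟩ := hW.exists_eq_mkQ_mul (IsLattice.coeSubmodule hJ) (f ∘ₗ e.symm.toLinearMap)
  refine ⟨LinearMap.toSpanSingleton A _ (W.mkQ z), fun a ha => ?_⟩
  calc a • W.mkQ z = W.mkQ (z * algebraMap A K a) := by
        rw [← map_smul, Algebra.smul_def, mul_comm]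
    _ = f (e.symm (e ⟨a, ha⟩)) := (hz (e ⟨a, ha⟩)).symm
    _ = f ⟨a, ha⟩ := by rw [e.symm_apply_apply]

end IsDualizing

end Duality

/-! ### Canonical modules are dualizing -/

section Ext

variable {A : Type u} [CommRing A]

theorem shortExact_subtype_mkQ {E : Type u} [AddCommGroup E] [Module A E] (D : Submodule A E) :
    (ModuleCat.shortComplexOfCompEqZero D.subtype D.mkQ
      (LinearMap.exact_subtype_mkQ D).linearMap_comp_eq_zero).ShortExact :=
  ModuleCat.shortComplex_shortExact _ (LinearMap.exact_subtype_mkQ D) D.subtype_injective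
    D.mkQ_surjective

theorem baer_of_subsingleton_ext {Y : Type u} [AddCommGroup Y] [Module A Y]
    (h : ∀ J : Ideal A, J ≠ ⊥ →
      Subsingleton (Abelian.Ext (ModuleCat.of A (A ⧸ J)) (ModuleCat.of A Y) 1)) :
    Module.Baer A Y := by
  refine baer_of_forall_ne_bot fun J hJ f => ?_
  have := h J hJ
  obtain ⟨g, hg⟩ := Abelian.Ext.contravariant_sequence_exact₁ (shortExact_subtype_mkQ J)
    (ModuleCat.of A Y) (Abelian.Ext.mk₀ (ModuleCat.ofHom f)) (add_zero 1)
    (Subsingleton.elim _ _)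
  obtain ⟨g, rfl⟩ := Abelian.Ext.homEquiv₀.symm.surjective g
  rw [Abelian.Ext.homEquiv₀_symm_apply, Abelian.Ext.mk₀_comp_mk₀] at hg
  have hg' := Abelian.Ext.homEquiv₀.symm.injective hg
  exact ⟨g.hom, fun a ha => LinearMap.congr_fun (congrArg ModuleCat.Hom.hom hg') ⟨a, ha⟩⟩

theorem subsingleton_ext_of_exact {X E Z : Type u} [AddCommGroup X] [Module A X] [AddCommGroup E]
    [Module A E] [AddCommGroup Z] [Module A Z] {f : X →ₗ[A] E} {g : E →ₗ[A] Z}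
    (h : Function.Exact f g) (hf : Function.Injective f) (hg : Function.Surjective g)
    (Y : ModuleCat.{u} A) (n : ℕ) (hX : Subsingleton (Abelian.Ext (ModuleCat.of A X) Y n))
    (hZ : Subsingleton (Abelian.Ext (ModuleCat.of A Z) Y n)) :
    Subsingleton (Abelian.Ext (ModuleCat.of A E) Y n) := by
  refine subsingleton_of_forall_eq 0 fun x => ?_
  obtain ⟨z, rfl⟩ := Abelian.Ext.contravariant_sequence_exact₂
    (ModuleCat.shortComplex_shortExact
      (ModuleCat.shortComplexOfCompEqZero f g h.linearMap_comp_eq_zero) h hf hg)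
    Y x (hX.elim _ _)
  rw [hZ.elim z 0, Abelian.Ext.comp_zero]

theorem hasProjectiveDimensionLT_quotient_span_singleton {b : A} (hb : b ∈ nonZeroDivisors A) :
    HasProjectiveDimensionLT (ModuleCat.of A (A ⧸ Ideal.span {b})) 2 := by
  have hexact : Function.Exact (LinearMap.toSpanSingleton A A b) (Ideal.span {b}).mkQ := by
    rw [LinearMap.exact_iff, Submodule.ker_mkQ, LinearMap.range_toSpanSingleton]
  have hA : Projective (ModuleCat.of A A) := (IsProjective.iff_projective A).1 inferInstance
  exact ((ModuleCat.shortComplex_shortExact (ModuleCat.shortComplexOfCompEqZero _ _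
    hexact.linearMap_comp_eq_zero) hexact (fun x y => (mul_cancel_right_mem_nonZeroDivisors hb).1)
    (Submodule.mkQ_surjective _)).hasProjectiveDimensionLT_X₃_iff 0 hA).2
      (projective_iff_hasProjectiveDimensionLT_one.1 hA)

variable [IsLocalRing A]

theorem exists_injective_residueField {X : Type*} [AddCommGroup X] [Module A X] [Nontrivial X]
    (hX : IsFiniteLength A X) : ∃ f : ResidueField A →ₗ[A] X, Function.Injective f := by
  have := (isFiniteLength_iff_isNoetherian_isArtinian.1 hX).2
  obtain ⟨N, hN⟩ := IsAtomic.exists_atom (Submodule A X)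
  have := isSimpleModule_iff_isAtom.2 hN
  obtain ⟨e⟩ := nonempty_linearEquiv_residueField (A := A) N
  exact ⟨N.subtype ∘ₗ e.symm, N.subtype_injective.comp e.symm.injective⟩

theorem subsingleton_ext_of_isFiniteLength {Y : ModuleCat.{u} A} {n : ℕ}
    (hY : Subsingleton (Abelian.Ext (ModuleCat.of A (ResidueField A)) Y n)) {X : Type u}
    [AddCommGroup X] [Module A X] (hX : IsFiniteLength A X) :
    Subsingleton (Abelian.Ext (ModuleCat.of A X) Y n) := by
  induction hX with
  | @of_subsingleton X =>
    have := (hasProjectiveDimensionLT_zero_iff_isZero (ModuleCat.of A X)).2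
      (ModuleCat.isZero_of_subsingleton _)
    exact HasProjectiveDimensionLT.subsingleton _ 0 n n.zero_le Y
  | @of_simple_quotient X _ _ N _ _ ih =>
    obtain ⟨e⟩ := nonempty_linearEquiv_residueField (A := A) (X ⧸ N)
    exact subsingleton_ext_of_exact (g := e.toLinearMap ∘ₗ N.mkQ)
      ((LinearMap.exact_subtype_mkQ N).comp_injective e e.injective e.map_zero)
      N.subtype_injective (e.surjective.comp N.mkQ_surjective) Y n ih hY

variable [IsNoetherianRing A] [Ring.KrullDimLE 1 A]

/-- For `b ∈ 𝔪` regular, `k` embeds into `A / b`, which has projective dimension at most `1`. -/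
theorem subsingleton_ext_residueField_of_succ {b : A} (hb : b ∈ nonZeroDivisors A)
    (hb' : b ∈ maximalIdeal A) {Y : ModuleCat.{u} A} {n : ℕ}
    (h : Subsingleton (Abelian.Ext (ModuleCat.of A (ResidueField A)) Y (n + 3))) :
    Subsingleton (Abelian.Ext (ModuleCat.of A (ResidueField A)) Y (n + 2)) := by
  have hX : IsFiniteLength A (A ⧸ Ideal.span {b}) := isFiniteLength_quotient_span_singleton A hb
  have : Nontrivial (A ⧸ Ideal.span {b}) := Ideal.Quotient.nontrivial_iff.2 fun h =>
    (maximalIdeal.isMaximal A).ne_top (top_le_iff.1 (h ▸ (Ideal.span_singleton_le_iff_mem _).2 hb'))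
  obtain ⟨f, hf⟩ := exists_injective_residueField hX
  have hC := subsingleton_ext_of_isFiniteLength h
    (hX.of_surjective f.range.mkQ_surjective)
  have := hasProjectiveDimensionLT_quotient_span_singleton hb
  have hP := HasProjectiveDimensionLT.subsingleton (ModuleCat.of A (A ⧸ Ideal.span {b})) 2 (n + 2)
    (Nat.le_add_left 2 n) Y
  refine subsingleton_of_forall_eq 0 fun x => ?_
  obtain ⟨z, rfl⟩ := Abelian.Ext.contravariant_sequence_exact₁
    (ModuleCat.shortComplex_shortExact (ModuleCat.shortComplexOfCompEqZero f f.range.mkQ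
      f.exact_map_mkQ_range.linearMap_comp_eq_zero) f.exact_map_mkQ_range hf
      f.range.mkQ_surjective)
    Y x (add_comm 1 (n + 2)) (hC.elim _ _)
  rw [hP.elim z 0, Abelian.Ext.comp_zero]

variable [IsDomain A]

theorem subsingleton_ext_two_residueField (hA : maximalIdeal A ≠ ⊥) {Y : ModuleCat.{u} A} (n : ℕ)
    (h : Subsingleton (Abelian.Ext (ModuleCat.of A (ResidueField A)) Y (n + 2))) :
    Subsingleton (Abelian.Ext (ModuleCat.of A (ResidueField A)) Y 2) := by
  obtain ⟨b, hb, hb₀⟩ := (maximalIdeal A).ne_bot_iff.1 hA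
  induction n with
  | zero => exact h
  | succ n ih =>
    exact ih (subsingleton_ext_residueField_of_succ (mem_nonZeroDivisors_of_ne_zero hb₀) hb h)

theorem injective_quotient_of_subsingleton_ext_two {E : Type u} [AddCommGroup E] [Module A E]
    [Module.Injective A E] (D : Submodule A E)
    (h : Subsingleton (Abelian.Ext (ModuleCat.of A (ResidueField A)) (ModuleCat.of A D) 2)) :
    Module.Injective A (E ⧸ D) := by
  have hE := Module.injective_object_of_injective_module A E
  refine (baer_of_subsingleton_ext fun J hJ => subsingleton_of_forall_eq 0 fun x => ?_).injective
  obtain ⟨c, hc, hc₀⟩ := J.ne_bot_iff.1 hJ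
  have hJ₂ := subsingleton_ext_of_isFiniteLength h <|
    (isFiniteLength_quotient_span_singleton A (mem_nonZeroDivisors_of_ne_zero hc₀)).of_surjective
      (Submodule.factor_surjective ((Ideal.span_singleton_le_iff_mem J).2 hc))
  obtain ⟨z, rfl⟩ := Abelian.Ext.covariant_sequence_exact₃ _ (shortExact_subtype_mkQ D) x
    one_add_one_eq_two (hJ₂.elim _ _)
  have hz : z = 0 := Abelian.Ext.eq_zero_of_injective z
  rw [hz, Abelian.Ext.zero_comp]

end Ext

section InjectiveQuotient

variable {A : Type u} [CommRing A] {K : Type u} [Field K] [Algebra A K] [IsFractionRing A K]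

variable (A K) in
theorem injective_fractionField : Module.Injective A K := by
  refine (baer_of_forall_ne_bot fun J hJ f => ?_).injective
  obtain ⟨b, hb, hb₀⟩ := J.ne_bot_iff.1 hJ
  have hbK : algebraMap A K b ≠ 0 := by simpa using hb₀
  refine ⟨LinearMap.toSpanSingleton A K (f ⟨b, hb⟩ / algebraMap A K b), fun a ha => ?_⟩
  have h : b • f ⟨a, ha⟩ = a • f ⟨b, hb⟩ := by
    rw [← map_smul, ← map_smul]
    exact congrArg f (Subtype.ext (mul_comm b a))
  rw [Algebra.smul_def, Algebra.smul_def] at h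
  rw [LinearMap.toSpanSingleton_apply, Algebra.smul_def, ← mul_div_assoc, ← h]
  exact mul_div_cancel_left₀ _ hbK

variable {W : Submodule A K}

theorem exists_mkQ_mul_eq (f : K →ₗ[A] K ⧸ W) {M : Submodule A K} (hM : IsLattice M) :
    ∃ z : K, ∀ m ∈ M, f m = W.mkQ (z * m) := by
  obtain ⟨b, hb, hle⟩ := hM.exists_span_singleton_mul_le (IsLattice.one (A := A))
  have : Nontrivial A := (algebraMap A K).domain_nontrivial
  have hb₀ : algebraMap A K b ≠ 0 := IsFractionRing.to_map_ne_zero_of_mem_nonZeroDivisors hb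
  obtain ⟨z, hz⟩ := W.mkQ_surjective (f (algebraMap A K b)⁻¹)
  refine ⟨algebraMap A K b * z, fun m hm => ?_⟩
  obtain ⟨a, ha⟩ := Submodule.mem_one.1
    (hle (Submodule.mul_mem_mul (Submodule.mem_span_singleton_self _) hm))
  have h₁ : m = a • (algebraMap A K b)⁻¹ := by
    rw [Algebra.smul_def, ha, mul_comm, inv_mul_cancel_left₀ hb₀]
  have h₂ : algebraMap A K b * z * m = a • z := by
    rw [Algebra.smul_def, ha]
    ring
  rw [h₂, map_smul, hz, ← map_smul, ← h₁]

theorem IsLattice.isFiniteLength_span_singleton [IsNoetherianRing A] [Ring.KrullDimLE 1 A]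
    (hW : IsLattice W) (q : K ⧸ W) : IsFiniteLength A (Submodule.span A {q}) := by
  have hqW := hW.comap_mkQ (Submodule.fg_span_singleton q)
  obtain ⟨b, hb, hle⟩ := hqW.exists_span_singleton_mul_le hW
  refine isFiniteLength_of_smul_eq_zero hb fun x => Subtype.ext ?_
  obtain ⟨y, hy⟩ := W.mkQ_surjective x
  rw [Submodule.coe_smul, ← hy, ← map_smul, ZeroMemClass.coe_zero, ← LinearMap.mem_ker, W.ker_mkQ,
    Algebra.smul_def]
  exact hle (Submodule.mul_mem_mul (Submodule.mem_span_singleton_self _) (hy ▸ x.2 :))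

variable [IsLocalRing A]

theorem IsLattice.ne_top (hA : maximalIdeal A ≠ ⊥) (hW : IsLattice W) : W ≠ ⊤ := by
  rintro rfl
  obtain ⟨b, hb, hle⟩ := hW.exists_span_singleton_mul_le (IsLattice.one (A := A))
  obtain ⟨c, hc, hc₀⟩ := (maximalIdeal A).ne_bot_iff.1 hA
  have hbK : algebraMap A K b ≠ 0 := IsFractionRing.to_map_ne_zero_of_mem_nonZeroDivisors hb
  have hcK : algebraMap A K c ≠ 0 := by simpa using hc₀
  obtain ⟨a, ha⟩ := Submodule.mem_one.1 <| hle <| Submodule.mul_mem_mul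
    (Submodule.mem_span_singleton_self _)
    (Submodule.mem_top (x := (algebraMap A K b)⁻¹ * (algebraMap A K c)⁻¹))
  rw [mul_inv_cancel_left₀ hbK, ← mul_eq_one_iff_eq_inv₀ hcK, ← map_mul,
    ← (algebraMap A K).map_one] at ha
  exact hc (IsUnit.of_mul_eq_one_right a (IsFractionRing.injective A K ha))

theorem exists_linearMap_apply_ne_zero {E X : Type u} [AddCommGroup E] [Module A E]
    [AddCommGroup X] [Module A X] [Module.Injective A E] {i : ResidueField A →ₗ[A] E}
    (hi : Function.Injective i) {x : X} (hx : x ≠ 0) : ∃ g : X →ₗ[A] E, g x ≠ 0 := by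
  have hx' : Ideal.torsionOf A X x ≤ maximalIdeal A :=
    le_maximalIdeal ((Ideal.torsionOf_eq_top_iff A x).not.2 hx)
  let e := Ideal.quotTorsionOfEquivSpanSingleton A X x
  have he : e.symm ⟨x, Submodule.mem_span_singleton_self x⟩ = Submodule.Quotient.mk 1 := by
    rw [LinearEquiv.symm_apply_eq, Ideal.quotTorsionOfEquivSpanSingleton_apply_mk, one_smul]
  let f : Submodule.span A {x} →ₗ[A] ResidueField A := Submodule.factor hx' ∘ₗ e.symm.toLinearMap
  have hf : f ⟨x, Submodule.mem_span_singleton_self x⟩ = 1 := congrArg (Submodule.factor hx') he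
  obtain ⟨g, hg⟩ := Module.Injective.out _ (Submodule.span A {x}).subtype_injective (i ∘ₗ f)
  refine ⟨g, ?_⟩
  have hgx := hg ⟨x, Submodule.mem_span_singleton_self x⟩
  rw [LinearMap.comp_apply, hf] at hgx
  exact fun h => one_ne_zero (hi (hgx.symm.trans (h.trans i.map_zero.symm)))

variable [IsNoetherianRing A] [Ring.KrullDimLE 1 A]

theorem IsLattice.exists_injective_residueField_quotient (hA : maximalIdeal A ≠ ⊥)
    (hW : IsLattice W) : ∃ i : ResidueField A →ₗ[A] K ⧸ W, Function.Injective i := by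
  have := Submodule.Quotient.nontrivial_iff.2 (hW.ne_top hA)
  obtain ⟨q, hq⟩ := exists_ne (0 : K ⧸ W)
  have : Nontrivial (Submodule.span A {q}) :=
    Submodule.nontrivial_iff_ne_bot.2 (Submodule.span_singleton_eq_bot.not.2 hq)
  obtain ⟨i, hi⟩ := exists_injective_residueField (hW.isFiniteLength_span_singleton q)
  exact ⟨(Submodule.span A {q}).subtype ∘ₗ i, (Submodule.span A {q}).subtype_injective.comp hi⟩

theorem isDualizing_of_injective_quotient (hA : maximalIdeal A ≠ ⊥) (hW : IsLattice W)
    [Module.Injective A (K ⧸ W)] : IsDualizing W := by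
  refine ⟨hW, fun {M} hM => le_antisymm (fun y hy => ?_) (le_div_div W M)⟩
  by_contra hyM
  obtain ⟨i, hi⟩ := hW.exists_injective_residueField_quotient hA
  obtain ⟨g, hg⟩ := exists_linearMap_apply_ne_zero hi (mt (Submodule.Quotient.mk_eq_zero M).1 hyM)
  have hy₀ : y ≠ 0 := fun h => hyM (h ▸ M.zero_mem)
  obtain ⟨z, hz⟩ := exists_mkQ_mul_eq (g ∘ₗ M.mkQ) (hM.sup (IsLattice.span_singleton hy₀))
  have hzM : z ∈ W / M := Submodule.mem_div_iff_forall_mul_mem.2 fun m hm => by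
    rw [← W.ker_mkQ, LinearMap.mem_ker, ← hz m (Submodule.mem_sup_left hm), LinearMap.comp_apply,
      Submodule.mkQ_apply, (Submodule.Quotient.mk_eq_zero M).2 hm, map_zero]
  refine hg ((hz y (Submodule.mem_sup_right (Submodule.mem_span_singleton_self y))).trans ?_)
  rw [← LinearMap.mem_ker, W.ker_mkQ, mul_comm]
  exact Submodule.mem_div_iff_forall_mul_mem.1 hy z hzM

variable [IsDomain A]

theorem isDualizing_of_isCanonicalModule (hA : maximalIdeal A ≠ ⊥)
    (hW : IsCanonicalModule A 1 W) (hW₀ : W ≠ ⊥) : IsDualizing W := by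
  have := injective_fractionField A K
  have := injective_quotient_of_subsingleton_ext_two W (hW.ext_eq_zero 2 (by decide))
  exact isDualizing_of_injective_quotient hA ⟨hW₀, Module.Finite.iff_fg.1 hW.finite⟩

variable (A K) in
theorem isGorensteinLocalRing_iff_isDualizing_one (hA : maximalIdeal A ≠ ⊥) :
    IsGorensteinLocalRing A ↔ IsDualizing (1 : Submodule A K) := by
  have := injective_fractionField A K
  let e : A ≃ₗ[A] (1 : Submodule A K) :=
    (LinearEquiv.ofInjective (Algebra.linearMap A K) (IsFractionRing.injective A K)).trans
      (LinearEquiv.ofEq _ _ Submodule.one_eq_range.symm)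
  constructor
  · rintro ⟨-, -, n, hn⟩
    have := hasInjectiveDimensionLT_of_iso e.toModuleIso n
    have := injective_quotient_of_subsingleton_ext_two _ (subsingleton_ext_two_residueField hA n
      (HasInjectiveDimensionLT.subsingleton (ModuleCat.of A (1 : Submodule A K)) n (n + 2)
        (Nat.le_add_right n 2) _))
    exact isDualizing_of_injective_quotient hA IsLattice.one
  · intro h
    have := h.injective_quotient
    have := Module.injective_object_of_injective_module A (K ⧸ (1 : Submodule A K))
    have : HasInjectiveDimensionLT (ModuleCat.of A (1 : Submodule A K)) 2 :=
      ((shortExact_subtype_mkQ (1 : Submodule A K)).hasInjectiveDimensionLT_X₃_iff 0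
        (Module.injective_object_of_injective_module A K)).1
        (inferInstanceAs (HasInjectiveDimensionLT (ModuleCat.of A (K ⧸ 1)) 1))
    exact ⟨inferInstance, inferInstance, 2,
      hasInjectiveDimensionLT_of_iso e.symm.toModuleIso 2⟩

end InjectiveQuotient

/-! ### Gorenstein overrings -/

section Uniqueness

variable {A : Type u} [CommRing A] [IsLocalRing A] {K : Type u} [Field K] [Algebra A K]

theorem exists_eq_span_singleton_of_mul_eq_one [FaithfulSMul A K] {M N : Submodule A K}
    (h : M * N = 1) : ∃ y : K, y ≠ 0 ∧ M = Submodule.span A {y} := by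
  obtain ⟨m, hm, n, hn, a, ha, hmn⟩ :
      ∃ m ∈ M, ∃ n ∈ N, ∃ a : A, IsUnit a ∧ algebraMap A K a = m * n := by
    by_contra! hcon
    have hle : (1 : Submodule A K) ≤ IsLocalization.coeSubmodule K (maximalIdeal A) := by
      rw [← h, Submodule.mul_le]
      intro m hm n hn
      obtain ⟨a, ha⟩ := Submodule.mem_one.1 (h ▸ Submodule.mul_mem_mul hm hn)
      exact ⟨a, fun hu => hcon m hm n hn a hu ha, ha⟩
    obtain ⟨a, ha, ha₁⟩ := hle (Submodule.one_le.1 le_rfl)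
    refine ha ?_
    rw [FaithfulSMul.algebraMap_injective A K (ha₁.trans (map_one _).symm)]
    exact isUnit_one
  refine ⟨m, left_ne_zero_of_mul (hmn ▸ (ha.map (algebraMap A K)).ne_zero),
    le_antisymm (fun x hx => ?_) ((Submodule.span_singleton_le_iff_mem _ _).2 hm)⟩
  obtain ⟨b, hb⟩ := Submodule.mem_one.1 (h ▸ Submodule.mul_mem_mul hx hn)
  refine ((Submodule.span A {m}).smul_mem_iff_of_isUnit ha).1
    (Submodule.mem_span_singleton.2 ⟨b, ?_⟩)
  rw [Algebra.smul_def, Algebra.smul_def, hb, hmn]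
  ring

theorem IsDualizing.isDualizing_one_iff [IsNoetherianRing A] [IsFractionRing A K]
    {W : Submodule A K} (hW : IsDualizing W) :
    IsDualizing (1 : Submodule A K) ↔ ∃ y : K, y ≠ 0 ∧ W = Submodule.span A {y} := by
  constructor
  · intro h₁
    have hinv : 1 / (W * (1 / W)) = 1 := by
      rw [mul_comm, div_mul_eq_div_div, h₁.div_div hW.toIsLattice, hW.div_self]
    have : Nontrivial A := (algebraMap A K).domain_nontrivial
    have := (faithfulSMul_iff_algebraMap_injective A K).2 (IsFractionRing.injective A K)
    refine exists_eq_span_singleton_of_mul_eq_one (N := 1 / W) ?_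
    rw [← h₁.div_div (hW.mul (h₁.div hW.toIsLattice)), hinv, div_one']
  · rintro ⟨y, hy, rfl⟩
    refine ⟨IsLattice.one, fun {M} hM => ?_⟩
    have hdiv (N : Submodule A K) :
        1 / N = Submodule.span A {y⁻¹} * (Submodule.span A {y} / N) := by
      rw [← span_singleton_mul_div (inv_ne_zero hy), span_singleton_inv_mul_span_singleton A hy]
    rw [hdiv M, div_span_singleton_mul (inv_ne_zero hy), inv_inv, hdiv, ← mul_assoc, mul_comm
      (Submodule.span A {y}), span_singleton_inv_mul_span_singleton A hy, one_mul, hW.div_div hM]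

end Uniqueness

section Overring

variable {R : Type u} [CommRing R] {K : Type u} [Field K] [Algebra R K]

theorem isFractionRing_subalgebra [IsFractionRing R K] (L : Subalgebra R K) :
    IsFractionRing L K := by
  refine IsFractionRing.of_field L K fun z => ?_
  obtain ⟨a, b, -, rfl⟩ := IsFractionRing.div_surjective (A := R) z
  exact ⟨algebraMap R L a, algebraMap R L b, rfl⟩

theorem isLocalRing_of_le_integralClosure [IsLocalRing (integralClosure R K)]
    {L : Subalgebra R K} (hL : L ≤ integralClosure R K) : IsLocalRing L := by
  have hint : (Subalgebra.inclusion hL).toRingHom.IsIntegral := by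
    refine RingHom.IsIntegral.tower_top (algebraMap R L) _ fun y => ?_
    exact Algebra.IsIntegral.isIntegral (R := R) y
  have := hint.isLocalHom (Subalgebra.inclusion_injective hL)
  exact (Subalgebra.inclusion hL).toRingHom.domain_isLocalRing

theorem krullDimLE_one_of_isIntegral [IsDomain R] [Ring.KrullDimLE 1 R] (L : Subalgebra R K)
    [Algebra.IsIntegral R L] : Ring.KrullDimLE 1 L := by
  rw [Ring.krullDimLE_one_iff_of_noZeroDivisors]
  intro p hp hprime
  obtain ⟨y, hy, hy₀⟩ := p.ne_bot_iff.1 hp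
  have hcomap : p.comap (algebraMap R L) ≠ ⊥ :=
    Ideal.comap_ne_bot_of_integral_mem hy₀ hy (Algebra.IsIntegral.isIntegral y)
  exact Ideal.isMaximal_of_isIntegral_of_isMaximal_comap p
    ((hprime.comap (algebraMap R L)).isMaximal_of_ne_bot hcomap)

theorem maximalIdeal_ne_bot_of_isIntegral [IsLocalRing R] [FaithfulSMul R K]
    (L : Subalgebra R K) [Algebra.IsIntegral R L] [IsLocalRing L]
    (hR : maximalIdeal R ≠ ⊥) : maximalIdeal L ≠ ⊥ := by
  have hinj : Function.Injective (algebraMap R L) := fun _ _ h =>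
    FaithfulSMul.algebraMap_injective R K (congrArg Subtype.val h)
  intro hL
  refine hR ?_
  rw [← eq_maximalIdeal (Ideal.isMaximal_comap_of_isIntegral_of_isMaximal (maximalIdeal L)), hL]
  exact Ideal.comap_bot_of_injective _ hinj

variable {L : Subalgebra R K}

theorem restrictScalars_one :
    (1 : Submodule L K).restrictScalars R = Subalgebra.toSubmodule L := by
  ext z
  rw [Submodule.restrictScalars_mem, Submodule.mem_one, Subalgebra.mem_toSubmodule]
  exact ⟨fun ⟨l, hl⟩ => hl ▸ l.2, fun h => ⟨⟨z, h⟩, rfl⟩⟩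

theorem restrictScalars_span_singleton (y : K) :
    (Submodule.span L {y}).restrictScalars R =
      Submodule.span R {y} * Subalgebra.toSubmodule L := by
  ext z
  rw [Submodule.restrictScalars_mem, Submodule.mem_span_singleton,
    Submodule.mem_span_singleton_mul]
  constructor
  · rintro ⟨l, rfl⟩
    exact ⟨l, l.2, mul_comm _ _⟩
  · rintro ⟨l, hl, rfl⟩
    exact ⟨⟨l, hl⟩, mul_comm _ _⟩

theorem IsLattice.restrictScalars [Module.Finite R L] {M : Submodule L K} (hM : IsLattice M) :
    IsLattice (M.restrictScalars R) :=
  ⟨fun h => hM.ne_bot ((Submodule.restrictScalars_eq_bot_iff R L K).1 h), hM.fg.restrictScalars⟩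

theorem IsLattice.toSubmodule [Module.Finite R L] : IsLattice (Subalgebra.toSubmodule L) :=
  restrictScalars_one (L := L) ▸ IsLattice.one.restrictScalars

theorem IsLattice.of_restrictScalars {M : Submodule L K} (hM : IsLattice (M.restrictScalars R)) :
    IsLattice M :=
  ⟨fun h => hM.ne_bot ((Submodule.restrictScalars_eq_bot_iff R L K).2 h),
    hM.fg.of_restrictScalars R⟩

/-- The colon `W : L` of an `R`-module `W ⊆ K` by an overring `L`, as an `L`-module. If `W` is
canonical for `R`, then this is canonical for `L`. -/
def overColon (L : Subalgebra R K) (W : Submodule R K) : Submodule L K where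
  __ := W / Subalgebra.toSubmodule L
  smul_mem' l z hz := Submodule.mem_div_iff_forall_mul_mem.2 fun m hm => by
    rw [Subalgebra.smul_def, smul_eq_mul, mul_comm (l : K), mul_assoc]
    exact Submodule.mem_div_iff_forall_mul_mem.1 hz _ (L.mul_mem l.2 hm)

theorem restrictScalars_overColon (W : Submodule R K) :
    (overColon L W).restrictScalars R = W / Subalgebra.toSubmodule L := rfl

theorem toSubmodule_mul_restrictScalars (M : Submodule L K) :
    Subalgebra.toSubmodule L * M.restrictScalars R = M.restrictScalars R := by
  refine le_antisymm (Submodule.mul_le.2 fun l hl m hm => ?_) fun m hm => ?_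
  · exact M.smul_mem (⟨l, hl⟩ : L) hm
  · rw [← one_mul m]
    exact Submodule.mul_mem_mul L.one_mem hm

theorem restrictScalars_overColon_div (W : Submodule R K) (M : Submodule L K) :
    (overColon L W / M).restrictScalars R = W / M.restrictScalars R := by
  have h : (overColon L W / M).restrictScalars R =
      (W / Subalgebra.toSubmodule L) / M.restrictScalars R := by
    ext z
    simp only [Submodule.restrictScalars_mem, Submodule.mem_div_iff_forall_mul_mem]
    rfl
  rw [h, ← div_mul_eq_div_div, toSubmodule_mul_restrictScalars]

variable [IsNoetherianRing R] [IsFractionRing R K] [Module.Finite R L] {W : Submodule R K}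

theorem IsDualizing.overColon (hW : IsDualizing W) : IsDualizing (overColon L W) where
  toIsLattice := (hW.div IsLattice.toSubmodule).of_restrictScalars
  div_div hM := Submodule.restrictScalars_injective R L K <| by
    rw [restrictScalars_overColon_div, restrictScalars_overColon_div,
      hW.div_div hM.restrictScalars]

theorem isGorensteinLocalRing_overring_iff [IsDomain R] [IsLocalRing R] [Ring.KrullDimLE 1 R]
    [IsLocalRing L] (hR : maximalIdeal R ≠ ⊥) (hW : IsDualizing W) :
    IsGorensteinLocalRing L ↔ ∃ y : K, y ≠ 0 ∧
      W / Subalgebra.toSubmodule L = Submodule.span R {y} * Subalgebra.toSubmodule L := by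
  have := isFractionRing_subalgebra L
  have := krullDimLE_one_of_isIntegral L
  have := IsNoetherianRing.of_finite R L
  have := (faithfulSMul_iff_algebraMap_injective R K).2 (IsFractionRing.injective R K)
  rw [isGorensteinLocalRing_iff_isDualizing_one L K (maximalIdeal_ne_bot_of_isIntegral L hR),
    (hW.overColon (L := L)).isDualizing_one_iff]
  simp only [← (Submodule.restrictScalars_injective R L K).eq_iff, restrictScalars_overColon,
    restrictScalars_span_singleton]

end Overring

/-! ### Reductions and the Hilbert series -/

section Reduction

variable {R : Type u} [CommRing R] {K : Type u} [Field K] [Algebra R K] {I : Ideal R} {x : R}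

theorem IsMinimalReduction.pow_succ_eq (hx : IsMinimalReduction I x) {n : ℕ}
    (hn : reductionExponent I x ≤ n) : I ^ (n + 1) = Ideal.span {x} * I ^ n :=
  Nat.sInf_mem (s := {m : ℕ | ∀ n ≥ m, I ^ (n + 1) = Ideal.span {x} * I ^ n}) hx.2 n hn

theorem idealPow_zero (I : Ideal R) : idealPow K I 0 = 1 := by
  rw [idealPow, pow_zero, Ideal.one_eq_top, IsLocalization.coeSubmodule_top]

theorem idealPow_add (I : Ideal R) (m n : ℕ) :
    idealPow K I (m + n) = idealPow K I m * idealPow K I n := by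
  rw [idealPow, pow_add, IsLocalization.coeSubmodule_mul]
  rfl

theorem idealPow_antitone (I : Ideal R) : Antitone (idealPow K I) := fun _ _ h =>
  IsLocalization.coeSubmodule_mono K (Ideal.pow_le_pow_right h)

theorem pow_mem_idealPow (hx : x ∈ I) (n : ℕ) : algebraMap R K x ^ n ∈ idealPow K I n :=
  (IsLocalization.mem_coeSubmodule K _).2 ⟨x ^ n, Ideal.pow_mem_pow hx n, map_pow _ _ _⟩

theorem IsMinimalReduction.idealPow_add_eq (hx : IsMinimalReduction I x) {n : ℕ}
    (hn : reductionExponent I x ≤ n) (m : ℕ) :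
    idealPow K I (n + m) = Submodule.span R {algebraMap R K x ^ m} * idealPow K I n := by
  induction m with
  | zero => rw [add_zero, pow_zero, ← Submodule.one_eq_span, one_mul]
  | succ m ih =>
    rw [← add_assoc, idealPow, hx.pow_succ_eq (by lia), IsLocalization.coeSubmodule_mul,
      IsLocalization.coeSubmodule_span_singleton, pow_succ', ← Set.singleton_mul_singleton,
      ← Submodule.span_mul_span, mul_assoc, ← ih]
    rfl

theorem hilbertLength_eq_quotLength [FaithfulSMul R K] (I : Ideal R) (n : ℕ) :
    hilbertLength I n = quotLength (idealPow K I n) (idealPow K I (n + 1)) :=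
  (length_quotient_map (Algebra.linearMap R K) (FaithfulSMul.algebraMap_injective R K) (I ^ n)
    (I ^ (n + 1))).symm

variable [IsDomain R] [IsFractionRing R K]

variable (K) in
theorem IsMinimalReduction.algebraMap_ne_zero (hx : IsMinimalReduction I x) (hI : I ≠ ⊥) :
    algebraMap R K x ≠ 0 := by
  rw [Ne, FaithfulSMul.algebraMap_eq_zero_iff]
  rintro rfl
  have h := hx.pow_succ_eq le_rfl
  rw [Ideal.span_singleton_zero, Ideal.bot_mul] at h
  exact pow_ne_zero _ hI h

theorem IsMinimalReduction.toSubmodule_blowup (hx : IsMinimalReduction I x) (hI : I ≠ ⊥) :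
    Subalgebra.toSubmodule (blowup K I) =
      idealPow K I (reductionExponent I x) / idealPow K I (reductionExponent I x) := by
  refine le_antisymm (fun z hz => ?_) fun z hz => Set.mem_iUnion.2 ⟨_, hz⟩
  obtain ⟨n, hn⟩ := Set.mem_iUnion.1 (show z ∈ ⋃ n : ℕ,
    ((idealPow K I n / idealPow K I n : Submodule R K) : Set K) from hz)
  have hn' := div_idealPow_mono I (le_max_right (reductionExponent I x) n) hn
  obtain ⟨k, hk⟩ := Nat.exists_eq_add_of_le (le_max_left (reductionExponent I x) n)
  have hxk := pow_ne_zero k (hx.algebraMap_ne_zero K hI)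
  dsimp only at hn'
  rwa [hk, hx.idealPow_add_eq le_rfl, div_span_singleton_mul hxk, span_singleton_mul_div hxk,
    ← mul_assoc, span_singleton_inv_mul_span_singleton R hxk, one_mul] at hn'

theorem IsMinimalReduction.span_pow_mul_blowup (hx : IsMinimalReduction I x) (hI : I ≠ ⊥) :
    Submodule.span R {algebraMap R K x ^ reductionExponent I x} *
      Subalgebra.toSubmodule (blowup K I) = idealPow K I (reductionExponent I x) := by
  rw [hx.toSubmodule_blowup hI]
  apply le_antisymm
  · refine (mul_le_mul_left ((Submodule.span_singleton_le_iff_mem _ _).2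
      (pow_mem_idealPow hx.1 _)) _).trans ?_
    rw [mul_comm]
    exact Submodule.le_div_iff_mul_le.1 le_rfl
  · rw [← span_singleton_mul_div (pow_ne_zero _ (hx.algebraMap_ne_zero K hI)),
      ← hx.idealPow_add_eq le_rfl, idealPow_add]
    exact Submodule.le_div_iff_mul_le.2 le_rfl

theorem IsMinimalReduction.span_pow_mul_blowup_le_one (hx : IsMinimalReduction I x)
    (hI : I ≠ ⊥) :
    Submodule.span R {algebraMap R K x ^ reductionExponent I x} *
      Subalgebra.toSubmodule (blowup K I) ≤ 1 := by
  rw [hx.span_pow_mul_blowup hI, ← idealPow_zero I]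
  exact idealPow_antitone I (Nat.zero_le _)

variable [IsNoetherianRing R]

theorem isLattice_idealPow (hI : I ≠ ⊥) (n : ℕ) : IsLattice (idealPow K I n) :=
  IsLattice.coeSubmodule (pow_ne_zero n hI)

theorem IsMinimalReduction.isLattice_blowup (hx : IsMinimalReduction I x) (hI : I ≠ ⊥) :
    IsLattice (Subalgebra.toSubmodule (blowup K I)) :=
  hx.toSubmodule_blowup (K := K) hI ▸ (isLattice_idealPow hI _).div (isLattice_idealPow hI _)

end Reduction

section Hilbert

open Polynomial

/-- For a power series `f = ∑ aₙ zⁿ` whose coefficients are constant from `ν` on, the polynomial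
`h` with `f = h / (1 - z)`, namely `(1 - z) ∑_{n < ν} aₙ zⁿ + a_ν z^ν`. -/
noncomputable def numerator (f : PowerSeries ℤ) (ν : ℕ) : ℤ[X] :=
  (1 - X) * f.trunc ν + C (f.coeff ν) * X ^ ν

theorem coe_numerator {f : PowerSeries ℤ} {ν : ℕ} (h : ∀ n ≥ ν, f.coeff n = f.coeff ν) :
    (numerator f ν : PowerSeries ℤ) = (1 - PowerSeries.X) * f := by
  have hshift : (PowerSeries.mk fun i => f.coeff (i + ν)) =
      PowerSeries.C (f.coeff ν) * PowerSeries.mk 1 := by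
    ext n
    rw [PowerSeries.coeff_mk, PowerSeries.coeff_C_mul, PowerSeries.coeff_mk, Pi.one_apply, mul_one,
      h (n + ν) (Nat.le_add_left ν n)]
  have hgeom : PowerSeries.mk 1 * (1 - PowerSeries.X : PowerSeries ℤ) = 1 :=
    PowerSeries.mk_one_mul_one_sub_eq_one ℤ
  conv_rhs => rw [f.eq_X_pow_mul_shift_add_trunc ν, hshift]
  simp only [numerator, coe_add, coe_mul, coe_sub, coe_one, coe_X, coe_C, coe_pow]
  linear_combination (-PowerSeries.C (f.coeff ν) * PowerSeries.X ^ ν) * hgeom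

theorem eval_one_numerator (f : PowerSeries ℤ) (ν : ℕ) :
    (numerator f ν).eval 1 = f.coeff ν := by
  simp [numerator]

theorem eval_one_derivative_numerator (f : PowerSeries ℤ) (ν : ℕ) :
    (derivative (numerator f ν)).eval 1 =
      f.coeff ν * ν - ∑ n ∈ Finset.range ν, f.coeff n := by
  have htrunc : (f.trunc ν).eval 1 = ∑ n ∈ Finset.range ν, f.coeff n := by
    simpa using PowerSeries.eval₂_trunc_eq_sum_range 1 (RingHom.id ℤ) ν f
  simp only [numerator, derivative_add, derivative_mul, derivative_sub, derivative_one,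
    derivative_X, derivative_C, derivative_X_pow, eval_add, eval_mul, eval_sub, eval_one, eval_X,
    eval_C, eval_pow, eval_zero, htrunc]
  ring

theorem IsHPolynomial.hPolynomial_eq {R : Type u} [CommRing R] {I : Ideal R} {p : ℤ[X]}
    (h : IsHPolynomial I p) : hPolynomial I = p := by
  have hex : ∃ p, IsHPolynomial I p := ⟨p, h⟩
  rw [hPolynomial, dif_pos hex]
  exact Polynomial.coe_injective ℤ (hex.choose_spec.trans h.symm)

end Hilbert

section Invariants

variable {R : Type u} [CommRing R] [IsDomain R] [IsNoetherianRing R] [Ring.KrullDimLE 1 R]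
  {K : Type u} [Field K] [Algebra R K] [IsFractionRing R K] {I : Ideal R}

theorem hilbertLength_ne_top (hI : I ≠ ⊥) (n : ℕ) : hilbertLength I n ≠ ⊤ := by
  rw [hilbertLength_eq_quotLength (K := FractionRing R)]
  exact (isLattice_idealPow hI n).quotLength_ne_top (isLattice_idealPow hI (n + 1))

variable (K) in
theorem coeff_hilbertSeries (hI : I ≠ ⊥) (n : ℕ) :
    (hilbertSeries I).coeff n = deg (idealPow K I n) - deg (idealPow K I (n + 1)) := by
  rw [hilbertSeries, PowerSeries.coeff_mk, hilbertLength_eq_quotLength (K := K),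
    toNat_quotLength (isLattice_idealPow hI n) (isLattice_idealPow hI (n + 1))
      (idealPow_antitone I n.le_succ)]

namespace IsMinimalReduction

variable {x : R} (hx : IsMinimalReduction I x) (hI : I ≠ ⊥)
include hx hI

variable (K) in
theorem coeff_hilbertSeries_of_le {n : ℕ} (hn : reductionExponent I x ≤ n) :
    (hilbertSeries I).coeff n = - deg (Submodule.span R {algebraMap R K x}) := by
  rw [coeff_hilbertSeries K hI, hx.idealPow_add_eq hn, pow_one,
    deg_span_singleton_mul (hx.algebraMap_ne_zero K hI) (isLattice_idealPow hI n)]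
  ring

theorem isHPolynomial_numerator :
    IsHPolynomial I (numerator (hilbertSeries I) (reductionExponent I x)) :=
  coe_numerator fun n hn => by
    rw [hx.coeff_hilbertSeries_of_le (FractionRing R) hI hn,
      hx.coeff_hilbertSeries_of_le (FractionRing R) hI le_rfl]

theorem isHPolynomial_hPolynomial : IsHPolynomial I (hPolynomial I) :=
  (hx.isHPolynomial_numerator hI).hPolynomial_eq ▸ hx.isHPolynomial_numerator hI

variable (K) in
theorem multiplicity_eq : multiplicity I = - deg (Submodule.span R {algebraMap R K x}) := by
  rw [multiplicity, (hx.isHPolynomial_numerator hI).hPolynomial_eq, eval_one_numerator,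
    hx.coeff_hilbertSeries_of_le K hI le_rfl]

variable (K) in
theorem multiplicity_mul_reductionExponent :
    multiplicity I * reductionExponent I x =
      -deg (Submodule.span R {algebraMap R K x ^ reductionExponent I x}) := by
  rw [hx.multiplicity_eq K hI, deg_span_pow (hx.algebraMap_ne_zero K hI)]
  ring

variable (K) in
theorem deg_idealPow_reductionExponent :
    deg (idealPow K I (reductionExponent I x)) =
      deg (Subalgebra.toSubmodule (blowup K I)) - multiplicity I * reductionExponent I x := by
  rw [← hx.span_pow_mul_blowup hI, hx.multiplicity_mul_reductionExponent K hI,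
    deg_span_singleton_mul (pow_ne_zero _ (hx.algebraMap_ne_zero K hI)) (hx.isLattice_blowup hI)]
  ring

variable (K) in
theorem genus_eq_deg_blowup : genus I = deg (Subalgebra.toSubmodule (blowup K I)) := by
  have hν := hx.deg_idealPow_reductionExponent K hI
  rw [hx.multiplicity_eq K hI] at hν
  rw [genus, (hx.isHPolynomial_numerator hI).hPolynomial_eq, eval_one_derivative_numerator,
    hx.coeff_hilbertSeries_of_le K hI le_rfl]
  simp only [coeff_hilbertSeries K hI]
  rw [Finset.sum_range_sub', hν, idealPow_zero, deg_one]
  ring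

end IsMinimalReduction

end Invariants

/-! ### Conductors and the genus -/

section Conductor

variable {R : Type u} [CommRing R] {K : Type u} [Field K] [Algebra R K]

theorem one_le_toSubmodule (L : Subalgebra R K) : 1 ≤ Subalgebra.toSubmodule L :=
  Submodule.one_le.2 L.one_mem

theorem le_integralClosure_of_finite (L : Subalgebra R K) [Module.Finite R L] :
    L ≤ integralClosure R K := fun z hz =>
  (Algebra.IsIntegral.isIntegral (R := R) (⟨z, hz⟩ : L)).map L.val

theorem mul_Rbar {M : Submodule R K} (h₁ : 1 ≤ M) (hM : M ≤ Rbar R K) :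
    M * Rbar R K = Rbar R K :=
  le_antisymm
    ((mul_le_mul_left hM _).trans (integralClosure R K).isIdempotentElem_toSubmodule.le)
    (le_mul_of_one_le_left' h₁)

theorem toSubmodule_div_Rbar_le (L : Subalgebra R K) [Module.Finite R L] :
    Subalgebra.toSubmodule L / Rbar R K ≤ Rbar R K :=
  (div_le_div_left (one_le_toSubmodule (integralClosure R K)) _).trans
    ((div_one' _).le.trans (le_integralClosure_of_finite L))

theorem IsDualizing.one_div {W : Submodule R K} (hW : IsDualizing W) (M : Submodule R K) :
    1 / M = W / (W * M) := by
  rw [div_mul_eq_div_div, hW.div_self]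

variable (R K) in
theorem isLattice_Rbar [Module.Finite R (integralClosure R K)] : IsLattice (Rbar R K) :=
  IsLattice.toSubmodule

section OneDiv

variable {L : Subalgebra R K} {W : Submodule R K} {y : K}

theorem span_singleton_mul_le_one_div (h : Submodule.span R {y} * Subalgebra.toSubmodule L ≤ 1) :
    Submodule.span R {y} * Subalgebra.toSubmodule L ≤ 1 / Subalgebra.toSubmodule L := by
  rwa [Submodule.le_div_iff_mul_le, mul_assoc, L.isIdempotentElem_toSubmodule.eq]

theorem mul_toSubmodule_eq_iff_le_one_div (hy : y ≠ 0) (hW : 1 ≤ W)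
    (h : 1 / Subalgebra.toSubmodule L = Submodule.span R {y} * Subalgebra.toSubmodule L) :
    W * Subalgebra.toSubmodule L = Subalgebra.toSubmodule L ↔
      Submodule.span R {y} * Subalgebra.toSubmodule L ≤ 1 / W := by
  set Λ := Subalgebra.toSubmodule L
  have hΛ : Λ * Λ = Λ := L.isIdempotentElem_toSubmodule
  calc W * Λ = Λ ↔ W * Λ ≤ Λ :=
        ⟨le_of_eq, fun h => h.antisymm (le_mul_of_one_le_left' hW)⟩
    _ ↔ Submodule.span R {y} * (W * Λ) ≤ 1 / Λ := by
        rw [h, span_singleton_mul_le_iff hy, ← mul_assoc,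
          span_singleton_inv_mul_span_singleton R hy, one_mul]
    _ ↔ Submodule.span R {y} * Λ ≤ 1 / W := by
        rw [Submodule.le_div_iff_mul_le, Submodule.le_div_iff_mul_le, mul_assoc, mul_assoc, hΛ,
          mul_assoc, mul_comm W]

end OneDiv

theorem IsDualizing.one_div_eq_and_mul_eq_iff {L : Subalgebra R K} [Module.Finite R L]
    {W : Submodule R K} (hW : IsDualizing W) (hW₁ : 1 ≤ W) {y : K}
    (hy : Submodule.span R {y} * Subalgebra.toSubmodule L ≤ 1) :
    1 / Subalgebra.toSubmodule L = Submodule.span R {y} * Subalgebra.toSubmodule L ∧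
        W * Subalgebra.toSubmodule L = Subalgebra.toSubmodule L ↔
      W / Subalgebra.toSubmodule L = Submodule.span R {y} * Subalgebra.toSubmodule L := by
  have hΛ := IsLattice.toSubmodule (L := L)
  constructor
  · rintro ⟨h, hmul⟩
    rw [← h, hW.one_div, hmul]
  · intro h
    have heq : 1 / Subalgebra.toSubmodule L = W / Subalgebra.toSubmodule L :=
      le_antisymm (div_le_div_right hW₁ _) (h.le.trans (span_singleton_mul_le_one_div hy))
    refine ⟨heq.trans h, ?_⟩
    rw [← hW.div_div (hW.mul hΛ), ← hW.one_div, heq, hW.div_div hΛ]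

variable [IsNoetherianRing R] [IsFractionRing R K] [Module.Finite R (integralClosure R K)]
  [Ring.KrullDimLE 1 R] (L : Subalgebra R K) [Module.Finite R L]

theorem deltaLength_ne_top : deltaLength L ≠ ⊤ :=
  (isLattice_Rbar R K).quotLength_ne_top IsLattice.toSubmodule

theorem condLength_ne_top : condLength L ≠ ⊤ :=
  (isLattice_Rbar R K).quotLength_ne_top (IsLattice.toSubmodule.div (isLattice_Rbar R K))

theorem toNat_deltaLength :
    ((deltaLength L).toNat : ℤ) = deg (Rbar R K) - deg (Subalgebra.toSubmodule L) :=
  toNat_quotLength (isLattice_Rbar R K) IsLattice.toSubmodule (le_integralClosure_of_finite L)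

theorem toNat_condLength :
    ((condLength L).toNat : ℤ) =
      deg (Rbar R K) - deg (Subalgebra.toSubmodule L / Rbar R K) :=
  toNat_quotLength (isLattice_Rbar R K) (IsLattice.toSubmodule.div (isLattice_Rbar R K))
    (toSubmodule_div_Rbar_le L)

variable {W : Submodule R K} (hW : IsDualizing W) (hW₁ : 1 ≤ W) (hWR : W ≤ Rbar R K)
include hW hW₁ hWR

theorem two_mul_deltaLength_sub_condLength [IsLocalRing R] :
    2 * ((deltaLength (⊥ : Subalgebra R K)).toNat : ℤ) -
      (condLength (⊥ : Subalgebra R K)).toNat = deg W := by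
  rw [toNat_deltaLength, toNat_condLength, Algebra.toSubmodule_bot, deg_one, hW.one_div,
    mul_Rbar hW₁ hWR, hW.deg_div (isLattice_Rbar R K)]
  ring

theorem condLength_sub_condLength {y : K} (hy : y ≠ 0)
    (h : W / Subalgebra.toSubmodule L = Submodule.span R {y} * Subalgebra.toSubmodule L) :
    ((condLength (⊥ : Subalgebra R K)).toNat : ℤ) - (condLength L).toNat =
      -deg (Submodule.span R {y}) := by
  have hdiv : 1 / Rbar R K = Submodule.span R {y} * (Subalgebra.toSubmodule L / Rbar R K) := by
    rw [hW.one_div, mul_Rbar hW₁ hWR, ← span_singleton_mul_div hy, ← h, ← div_mul_eq_div_div,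
      mul_Rbar (one_le_toSubmodule L) (le_integralClosure_of_finite L)]
  rw [toNat_condLength, toNat_condLength, Algebra.toSubmodule_bot, hdiv,
    deg_span_singleton_mul hy (IsLattice.toSubmodule.div (isLattice_Rbar R K))]
  ring

theorem isGorensteinLocalRing_and_condLength_sub_eq_iff [IsDomain R] [IsLocalRing R]
    [IsLocalRing L] (hR : maximalIdeal R ≠ ⊥) {y : K} (hy : y ≠ 0)
    (hy₁ : Submodule.span R {y} * Subalgebra.toSubmodule L ≤ 1) :
    IsGorensteinLocalRing L ∧ ((condLength (⊥ : Subalgebra R K)).toNat : ℤ) -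
        (condLength L).toNat = -deg (Submodule.span R {y}) ↔
      W / Subalgebra.toSubmodule L = Submodule.span R {y} * Subalgebra.toSubmodule L := by
  have hL := IsLattice.toSubmodule (L := L)
  rw [isGorensteinLocalRing_overring_iff hR hW]
  constructor
  · rintro ⟨⟨z, hz, h⟩, hc⟩
    -- A generator of `W : L` has degree `c_L - c`, so `W : L` and its submodule `y L` are equal.
    rw [condLength_sub_condLength L hW hW₁ hWR hz h] at hc
    refine (eq_of_le_of_deg_le (hW.div hL) ((IsLattice.span_singleton hy).mul hL)
      ((span_singleton_mul_le_one_div hy₁).trans (div_le_div_right hW₁ _)) ?_)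
    rw [h, deg_span_singleton_mul hz hL, deg_span_singleton_mul hy hL]
    lia
  · exact fun h => ⟨⟨y, hy, h⟩, condLength_sub_condLength L hW hW₁ hWR hy h⟩

end Conductor

section Genus

variable {R : Type u} [CommRing R] [IsDomain R] {K : Type u} [Field K] [Algebra R K]
  [IsFractionRing R K] {I : Ideal R} {x : R}

namespace IsMinimalReduction

variable (hx : IsMinimalReduction I x) (hI : I ≠ ⊥)
include hx hI

theorem idealPow_le_one_div_blowup :
    idealPow K I (reductionExponent I x) ≤ 1 / Subalgebra.toSubmodule (blowup K I) := by
  have h := hx.span_pow_mul_blowup_le_one (K := K) hI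
  exact hx.span_pow_mul_blowup (K := K) hI ▸ span_singleton_mul_le_one_div h

variable [IsNoetherianRing R]

theorem finite_blowup : Module.Finite R (blowup K I) :=
  Module.Finite.iff_fg.2 (hx.isLattice_blowup hI).fg

theorem isLocalRing_blowup [IsLocalRing (integralClosure R K)] : IsLocalRing (blowup K I) :=
  have := hx.finite_blowup (K := K) hI
  isLocalRing_of_le_integralClosure (le_integralClosure_of_finite (blowup K I))

theorem two_mul_genus [IsLocalRing R] [Ring.KrullDimLE 1 R]
    [Module.Finite R (integralClosure R K)] {W : Submodule R K} (hW : IsDualizing W)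
    (hW₁ : 1 ≤ W) (hWR : W ≤ Rbar R K) :
    2 * genus I = multiplicity I * reductionExponent I x +
      (2 * ((deltaLength (⊥ : Subalgebra R K)).toNat : ℤ) -
        (condLength (⊥ : Subalgebra R K)).toNat) -
      (quotLength (1 / Subalgebra.toSubmodule (blowup K I))
        (idealPow K I (reductionExponent I x))).toNat -
      (quotLength (W * Subalgebra.toSubmodule (blowup K I))
        (Subalgebra.toSubmodule (blowup K I))).toNat := by
  have hΛ := hx.isLattice_blowup (K := K) hI
  rw [two_mul_deltaLength_sub_condLength hW hW₁ hWR,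
    toNat_quotLength (IsLattice.one.div hΛ) (isLattice_idealPow hI _)
      (hx.idealPow_le_one_div_blowup hI),
    toNat_quotLength (hW.mul hΛ) hΛ (le_mul_of_one_le_left' hW₁), hW.one_div,
    hW.deg_div (hW.mul hΛ), hx.deg_idealPow_reductionExponent K hI, hx.genus_eq_deg_blowup K hI]
  ring

end IsMinimalReduction

end Genus

theorem maximalIdeal_ne_bot_of_ringKrullDim_eq_one {R : Type u} [CommRing R] [IsLocalRing R]
    (hR : ringKrullDim R = 1) : maximalIdeal R ≠ ⊥ := fun h => by
  rw [ringKrullDim_eq_zero_of_isField (isField_iff_maximalIdeal_eq.2 h)] at hR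
  exact zero_ne_one hR

theorem ne_bot_of_radical_eq_maximalIdeal {R : Type u} [CommRing R] [IsDomain R] [IsLocalRing R]
    (hR : ringKrullDim R = 1) {I : Ideal R} (hI : I.radical = maximalIdeal R) : I ≠ ⊥ := by
  rintro rfl
  exact maximalIdeal_ne_bot_of_ringKrullDim_eq_one hR
    (hI.symm.trans (Ideal.isPrime_bot (α := R)).isRadical.radical)

end BlowUp

open BlowUp in
theorem proposition3p4_general {R : Type u} [CommRing R] [IsDomain R] [IsLocalRing R]
    [IsNoetherianRing R] {K : Type u} [Field K] [Algebra R K] [IsFractionRing R K]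
    [Module.Finite R (integralClosure R K)]
    (ω : Submodule R K) (hω : BlowUp.IsCanonicalModule R 1 ω)
    (hRω : 1 ≤ ω) (hωR : ω ≤ BlowUp.Rbar R K)
    (I : Ideal R) (hI : I ≠ ⊥) [IsLocalRing (BlowUp.blowup K I)]
    (x : R) (hx : BlowUp.IsMinimalReduction I x) :
    let L : Subalgebra R K := BlowUp.blowup K I
    let Λ : Submodule R K := Subalgebra.toSubmodule L
    let ν : ℕ := BlowUp.reductionExponent I x
    let Iν : Submodule R K := BlowUp.idealPow K I ν
    let e : ℤ := BlowUp.multiplicity I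
    let ρ : ℤ := BlowUp.genus I
    let δ : ℤ := ((BlowUp.deltaLength (⊥ : Subalgebra R K)).toNat : ℤ)
    let c : ℤ := ((BlowUp.condLength (⊥ : Subalgebra R K)).toNat : ℤ)
    let cΛ : ℤ := ((BlowUp.condLength L).toNat : ℤ)
    ((∀ n, BlowUp.hilbertLength I n ≠ ⊤) ∧
      BlowUp.IsHPolynomial I (BlowUp.hPolynomial I) ∧
      BlowUp.deltaLength (⊥ : Subalgebra R K) ≠ ⊤ ∧
      BlowUp.condLength (⊥ : Subalgebra R K) ≠ ⊤ ∧
      BlowUp.condLength L ≠ ⊤ ∧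
      (Iν ≤ 1 / Λ ∧ BlowUp.quotLength (1 / Λ) Iν ≠ ⊤) ∧
      (Λ ≤ ω * Λ ∧ BlowUp.quotLength (ω * Λ) Λ ≠ ⊤)) ∧
    2 * ρ = e * ν + (2 * δ - c) - ((BlowUp.quotLength (1 / Λ) Iν).toNat : ℤ)
      - ((BlowUp.quotLength (ω * Λ) Λ).toNat : ℤ) ∧
    2 * ρ ≤ e * ν + (2 * δ - c) ∧
    List.TFAE [
      2 * ρ = e * ν + (2 * δ - c),
      BlowUp.IsGorensteinLocalRing L ∧ c - cΛ = e * ν,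
      1 / Λ = Iν ∧ ω * Λ = Λ,
      1 / Λ = Iν ∧ Iν ≤ 1 / ω] := by
  intro L Λ ν Iν e ρ δ c cΛ
  have hdim : ringKrullDim R = 1 := by simpa using hω.dim_eq
  have : Ring.KrullDimLE 1 R := (Order.krullDimLE_iff _ _).2 hdim.le
  have hR := maximalIdeal_ne_bot_of_ringKrullDim_eq_one hdim
  have hW : IsDualizing ω := isDualizing_of_isCanonicalModule hR hω
    (ne_bot_of_le_ne_bot one_ne_zero hRω)
  have : Module.Finite R L := hx.finite_blowup hI
  have hΛ : IsLattice Λ := hx.isLattice_blowup hI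
  have hp := pow_ne_zero ν (hx.algebraMap_ne_zero K hI)
  have hp₁ := hx.span_pow_mul_blowup_le_one (K := K) hI
  have hIν : Submodule.span R {algebraMap R K x ^ ν} * Λ = Iν := hx.span_pow_mul_blowup hI
  have hIΛ : Iν ≤ 1 / Λ := hx.idealPow_le_one_div_blowup hI
  have hΛω : Λ ≤ ω * Λ := le_mul_of_one_le_left' hRω
  have hρ := hx.two_mul_genus hI hW hRω hωR
  refine ⟨⟨hilbertLength_ne_top hI, hx.isHPolynomial_hPolynomial hI, deltaLength_ne_top _,
    condLength_ne_top _, condLength_ne_top _,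
    ⟨hIΛ, (IsLattice.one.div hΛ).quotLength_ne_top (isLattice_idealPow hI ν)⟩,
    ⟨hΛω, (hW.mul hΛ).quotLength_ne_top hΛ⟩⟩, hρ, by lia, ?_⟩
  tfae_have 1 ↔ 3 := by
    rw [← toNat_quotLength_eq_zero_iff (IsLattice.one.div hΛ) (isLattice_idealPow hI ν) hIΛ,
      ← toNat_quotLength_eq_zero_iff (hW.mul hΛ) hΛ hΛω]
    lia
  tfae_have 2 ↔ 3 := by
    rw [hx.multiplicity_mul_reductionExponent K hI, ← hIν]
    exact (isGorensteinLocalRing_and_condLength_sub_eq_iff L hW hRω hωR hR hp hp₁).trans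
      (hW.one_div_eq_and_mul_eq_iff hRω hp₁).symm
  tfae_have 3 ↔ 4 := by
    rw [← hIν]
    exact and_congr_right (mul_toSubmodule_eq_iff_le_one_div hp hRω)
  tfae_finish

/-- `⊥ : Subalgebra R K` and `1 : Submodule R K` are the image of `R` in `K`, and `M / N` is the
colon `M : N` in `K`. -/
theorem proposition3p4 {R : Type u} [CommRing R] [IsDomain R] [IsLocalRing R] [IsNoetherianRing R]
    (hdim : ringKrullDim R = 1)
    [Infinite (IsLocalRing.ResidueField R)]
    {K : Type u} [Field K] [Algebra R K] [IsFractionRing R K]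
    [Module.Finite R (integralClosure R K)]
    [IsDiscreteValuationRing (integralClosure R K)]
    (hres : Function.Surjective
      (algebraMap R (IsLocalRing.ResidueField (integralClosure R K))))
    (ω : Submodule R K) (hω : BlowUp.IsCanonicalModule R 1 ω)
    (hRω : 1 ≤ ω) (hωR : ω ≤ BlowUp.Rbar R K)
    (I : Ideal R) (hI : I.radical = IsLocalRing.maximalIdeal R)
    (hInp : ¬ Submodule.IsPrincipal I)
    (x : R) (hx : BlowUp.IsMinimalReduction I x) :
    let L : Subalgebra R K := BlowUp.blowup K I
    let Λ : Submodule R K := Subalgebra.toSubmodule L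
    let ν : ℕ := BlowUp.reductionExponent I x
    let Iν : Submodule R K := BlowUp.idealPow K I ν
    let e : ℤ := BlowUp.multiplicity I
    let ρ : ℤ := BlowUp.genus I
    let δ : ℤ := ((BlowUp.deltaLength (⊥ : Subalgebra R K)).toNat : ℤ)
    let c : ℤ := ((BlowUp.condLength (⊥ : Subalgebra R K)).toNat : ℤ)
    let cΛ : ℤ := ((BlowUp.condLength L).toNat : ℤ)
    -- all the invariants are well defined
    ((∀ n, BlowUp.hilbertLength I n ≠ ⊤) ∧
      BlowUp.IsHPolynomial I (BlowUp.hPolynomial I) ∧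
      BlowUp.deltaLength (⊥ : Subalgebra R K) ≠ ⊤ ∧
      BlowUp.condLength (⊥ : Subalgebra R K) ≠ ⊤ ∧
      BlowUp.condLength L ≠ ⊤ ∧
      (Iν ≤ 1 / Λ ∧ BlowUp.quotLength (1 / Λ) Iν ≠ ⊤) ∧
      (Λ ≤ ω * Λ ∧ BlowUp.quotLength (ω * Λ) Λ ≠ ⊤)) ∧
    2 * ρ = e * ν + (2 * δ - c) - ((BlowUp.quotLength (1 / Λ) Iν).toNat : ℤ)
      - ((BlowUp.quotLength (ω * Λ) Λ).toNat : ℤ) ∧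
    2 * ρ ≤ e * ν + (2 * δ - c) ∧
    List.TFAE [
      2 * ρ = e * ν + (2 * δ - c),
      BlowUp.IsGorensteinLocalRing L ∧ c - cΛ = e * ν,
      1 / Λ = Iν ∧ ω * Λ = Λ,
      1 / Λ = Iν ∧ Iν ≤ 1 / ω] := by
  have hI₀ := BlowUp.ne_bot_of_radical_eq_maximalIdeal hdim hI
  have := hx.isLocalRing_blowup (K := K) hI₀
  exact proposition3p4_general ω hω hRω hωR I hI₀ x hx
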